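/- Let $\Sigma$ be a connected closed orientable surface of genus $g$ with $n\ge 0$ points removed (punctures), of hyperbolic type (that is, $2g-2+n>0$), let $x_0\in\Sigma$, let $K\le\pi_1(\Sigma,x_0)$ be a characteristic subgroup of finite index, let $\Gamma=\pi_1(\Sigma,x_0)/K$ be the corresponding finite characteristic quotient, and let $p\colon(\Sigma_\Gamma,e)\to(\Sigma,x_0)$ be the associated connected covering, so that $p_*\pi_1(\Sigma_\Gamma,e)=K$. Let $\psi$ be any automorphism of $\pi_1(\Sigma,x_0)$ that induces a nontrivial automorphism of $\Gamma$. (1) $\psi$ acts nontrivially on $H_1(\Sigma_\Gamma,\mathbb Z)$, where the action sends the class of a loop $\alpha$ at $e$ to the class of a loop $\beta$ at $e$ with $p_*[\beta]=\psi(p_*[\alpha])$. (2) In particular, if $\psi=f_*$ for a homeomorphism $f\colon\Sigma\to\Sigma$ with $f(x_0)=x_0$ (for instance if $\psi$ comes from an element of $\mathrm{Mod}^1(\Sigma)$), then $f$ has a unique lift to a homeomorphism $F\colon\Sigma_\Gamma\to\Sigma_\Gamma$ with $F(e)=e$, and $F_*\ne\mathrm{id}$ on $H_1(\Sigma_\Gamma,\mathbb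 Z)$. -/

import Mathlib

open CategoryTheory

noncomputable section

/-! ### The surface of genus `g` with `n` punctures -/

/-- The point with parameter `t ∈ [0, 1]` on the `k`-th side of the regular `N`-gon; the polygon is
realised as the closed unit disc, with its boundary circle cut into `N` equal arcs. -/
def sidePoint (N k : ℕ) (t : ℝ) : ℂ :=
  Complex.exp (2 * Real.pi * Complex.I * ((k + t : ℝ) / N))

/-- The pairing of the sides of a `(4 * g + 2 * m)`-gon given by the boundary word
`a₁ b₁ a₁⁻¹ b₁⁻¹ ⋯ a_g b_g a_g⁻¹ b_g⁻¹ c₁ c₁⁻¹ ⋯ c_m c_m⁻¹`. Sides are numbered from `0`. -/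
inductive SidePair (g m : ℕ) : ℕ → ℕ → Prop
  | handleA (i : ℕ) : i < g → SidePair g m (4 * i) (4 * i + 2)
  | handleB (i : ℕ) : i < g → SidePair g m (4 * i + 1) (4 * i + 3)
  | fold (j : ℕ) : j < m → SidePair g m (4 * g + 2 * j) (4 * g + 2 * j + 1)

/-- Two points of the polygon are glued if they correspond to each other under the identification
of a pair of sides; every pair is identified with reversal of the direction of the boundary, so
that the result is orientable. -/
def Glued (g m : ℕ) (x y : Metric.closedBall (0 : ℂ) 1) : Prop :=
  ∃ (k l : ℕ) (t : ℝ), SidePair g m k l ∧ t ∈ Set.Icc (0 : ℝ) 1 ∧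
    (x : ℂ) = sidePoint (4 * g + 2 * m) k t ∧ (y : ℂ) = sidePoint (4 * g + 2 * m) l (1 - t)

/-- The quotient of the polygon by its side pairing: for `0 < g + m` this is the closed orientable
surface of genus `g` (the folded pairs `c c⁻¹` do not change the genus). It has the quotient
topology. -/
abbrev ClosedSurface (g m : ℕ) : Type := Quot (Glued g m)

/-- The images of the corners of the polygon. For `0 < g + m` there are exactly `m + 1` of them: the
`m` tips between `c_j` and `c_j⁻¹`, and one point that is the image of all the other corners. -/
def cornerPoints (g m : ℕ) : Set (ClosedSurface g m) :=
  {x | ∃ (z : Metric.closedBall (0 : ℂ) 1) (k : ℕ),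
    (z : ℂ) = sidePoint (4 * g + 2 * m) k 0 ∧ Quot.mk _ z = x}

/-- The standard surface of genus `g` with `n` punctures (meant for `2 < 2 * g + n`): for `n = 0` it
is the closed surface obtained from the `4g`-gon, and for `n > 0` it is the complement of the `n`
corner points in the closed surface obtained from the `(4g + 2(n - 1))`-gon. It has the subspace
topology. -/
abbrev StandardSurface (g n : ℕ) : Type :=
  {x : ClosedSurface g (n - 1) // 0 < n → x ∉ cornerPoints g (n - 1)}

/-- `S` is an orientable surface of genus `g` with `n` punctures, of hyperbolic type, i.e. of
negative Euler characteristic `2 - 2g - n`. -/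
structure IsHyperbolicSurface (g n : ℕ) (S : Type*) [TopologicalSpace S] : Prop where
  hyperbolic : 2 < 2 * g + n
  homeo : Nonempty (S ≃ₜ StandardSurface g n)

/-! ### First singular homology and the homology class of a loop -/

universe u v

/-- The group `ℤ`, lifted to the universe `v`. -/
abbrev intCoeff : AddCommGrpCat.{v} := AddCommGrpCat.of (ULift.{v} ℤ)

/-- The first singular homology group `H₁(Y, ℤ)`. -/
abbrev H1 (Y : Type v) [TopologicalSpace Y] : AddCommGrpCat.{v} :=
  ((AlgebraicTopology.singularHomologyFunctor AddCommGrpCat.{v} 1).obj intCoeff).obj (TopCat.of Y)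

/-- The endomorphism of `H₁(Y, ℤ)` induced by a continuous self-map of `Y`. -/
abbrev H1map {Y : Type v} [TopologicalSpace Y] (F : C(Y, Y)) : H1 Y ⟶ H1 Y :=
  ((AlgebraicTopology.singularHomologyFunctor AddCommGrpCat.{v} 1).obj intCoeff).map
    (TopCat.ofHom F)

/-- A loop, viewed as a singular `1`-simplex. -/
def loopSimplex {Y : Type v} [TopologicalSpace Y] {e : Y} (α : Path e e) :
    (TopCat.toSSet.obj (TopCat.of Y)).obj (Opposite.op (SimplexCategory.mk 1)) :=
  TopCat.toSSetObj₁Equiv.symm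
    (TopCat.ofHom (α.toContinuousMap.comp ⟨ULift.down, continuous_uliftDown⟩))

lemma loopSimplex_boundary {Y : Type v} [TopologicalSpace Y] {e : Y} (α : Path e e) :
    (TopCat.toSSet.obj (TopCat.of Y)).ιChainComplex (R := intCoeff.{v}) (loopSimplex α) ≫
      ((TopCat.toSSet.obj (TopCat.of Y)).chainComplex intCoeff.{v}).d 1 0 = 0 := by
  have h0 : (TopCat.toSSet.obj (TopCat.of Y)).δ 0 (loopSimplex α) =
      TopCat.toSSetObj₀Equiv.symm (α 1) := TopCat.δ_zero_toSSetObj₁Equiv.symm _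
  have h1 : (TopCat.toSSet.obj (TopCat.of Y)).δ 1 (loopSimplex α) =
      TopCat.toSSetObj₀Equiv.symm (α 0) := TopCat.δ_one_toSSetObj₁Equiv.symm _
  rw [SSet.ιChainComplex_d, Fin.sum_univ_two, h0, h1]
  simp

/-- The class in `H₁(Y, ℤ)` of the singular cycle given by a loop in `Y` (the Hurewicz map). -/
def loopClass {Y : Type v} [TopologicalSpace Y] {e : Y} (α : Path e e) : H1 Y :=
  (((TopCat.toSSet.obj (TopCat.of Y)).chainComplex intCoeff.{v}).liftCycles
      ((TopCat.toSSet.obj (TopCat.of Y)).ιChainComplex (R := intCoeff.{v}) (loopSimplex α)) 0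
      (by simp) (loopSimplex_boundary α) ≫
    ((TopCat.toSSet.obj (TopCat.of Y)).chainComplex intCoeff.{v}).homologyπ 1) (ULift.up 1)

/-! ### Automorphisms acting on characteristic quotients and on the homology of covers -/

/-- The automorphism of the quotient of `G` by a characteristic subgroup `K` induced by an
automorphism of `G`. -/
def inducedAut {G : Type*} [Group G] (K : Subgroup G) [hK : K.Characteristic] (ψ : G ≃* G) :
    G ⧸ K ≃* G ⧸ K :=
  QuotientGroup.congr K K ψ (Subgroup.characteristic_iff_map_eq.1 hK ψ)

/-- `p : Y → S`, with base points `e` and `x₀ = p e`, is the connected covering space of `S`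
associated with the subgroup `K` of `π₁(S, x₀)`. -/
structure IsAssociatedCover {S : Type u} {Y : Type v} [TopologicalSpace S] [TopologicalSpace Y]
    {x₀ : S} (K : Subgroup (FundamentalGroup S x₀)) (p : C(Y, S)) (e : Y) (he : p e = x₀) :
    Prop where
  covering : IsCoveringMap p
  connected : PathConnectedSpace Y
  range_eq : (FundamentalGroup.mapOfEq p he).range = K

/-- The graph of the action on `H₁(Y, ℤ)` of an automorphism `ψ` of `π₁(S, x₀)` that preserves the
subgroup `p_* π₁(Y, e)`: the class of a loop `α` is sent to the class of a loop `β` whose image in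
`π₁(S, x₀)` is obtained by applying `ψ` to that of `α`. Every class is the class of a loop when `Y`
is path connected. -/
def H1Action {S : Type u} {Y : Type v} [TopologicalSpace S] [TopologicalSpace Y] {x₀ : S}
    (p : C(Y, S)) (e : Y) (he : p e = x₀)
    (ψ : FundamentalGroup S x₀ ≃* FundamentalGroup S x₀) (a b : H1 Y) : Prop :=
  ∃ α β : Path e e, loopClass α = a ∧ loopClass β = b ∧
    FundamentalGroup.mapOfEq p he (FundamentalGroup.fromPath (Path.Homotopic.Quotient.mk β)) =
      ψ (FundamentalGroup.mapOfEq p he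
        (FundamentalGroup.fromPath (Path.Homotopic.Quotient.mk α)))

/-- `F` is the lift of `f : S → S` to the covering space `p : Y → S` that fixes the base point. -/
def IsBasedLift {S : Type u} {Y : Type v} [TopologicalSpace S] [TopologicalSpace Y]
    (p : C(Y, S)) (e : Y) (f : S ≃ₜ S) (F : Y ≃ₜ Y) : Prop :=
  (∀ y, p (F y) = f (p y)) ∧ F e = e

end

noncomputable section

section Winding

variable {A : Type*} [TopologicalSpace A]

lemma UnitAddCircle.isCoveringMap_coe : IsCoveringMap ((↑) : ℝ → UnitAddCircle) :=
  AddCircle.isCoveringMap_coe 1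

lemma UnitAddCircle.coe_eq_coe_iff {a b : ℝ} :
    (a : UnitAddCircle) = b ↔ ∃ k : ℤ, a - b = k := by
  rw [← sub_eq_zero, ← AddCircle.coe_sub, AddCircle.coe_eq_zero_iff]
  simp [eq_comm]

lemma exists_real_lift [SimplyConnectedSpace A] [LocallyPathConnectedSpace A]
    (h : C(A, UnitAddCircle)) : ∃ g : C(A, ℝ), ∀ a, (g a : UnitAddCircle) = h a := by
  obtain ⟨a₀⟩ : Nonempty A := inferInstance
  obtain ⟨r, hr⟩ := QuotientAddGroup.mk_surjective (h a₀)
  obtain ⟨F, ⟨-, hF⟩, -⟩ := UnitAddCircle.isCoveringMap_coe.existsUnique_continuousMap_lifts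
    h a₀ r hr
  exact ⟨F, fun a ↦ congrFun hF a⟩

lemma exists_int_sub_eq [PreconnectedSpace A] {g g' : A → ℝ} (hg : Continuous g)
    (hg' : Continuous g') (h : ∀ a, (g a : UnitAddCircle) = g' a) :
    ∃ k : ℤ, ∀ a, g a - g' a = k := by
  by_cases hA : Nonempty A
  · obtain ⟨a₀⟩ := hA
    obtain ⟨k, hk⟩ := UnitAddCircle.coe_eq_coe_iff.1 (h a₀)
    refine ⟨k, fun a ↦ ?_⟩
    rw [← hk]
    have hk' : g a₀ = g' a₀ + k := by linarith
    have heq : g = fun a ↦ g' a + k :=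
      UnitAddCircle.isCoveringMap_coe.eq_of_comp_eq hg (by fun_prop) (by funext a; simp [h a]) a₀ hk'
    rw [congrFun heq a, hk]
    ring
  · exact ⟨0, fun a ↦ (hA ⟨a⟩).elim⟩

lemma real_lift_sub_eq [PreconnectedSpace A] {g g' : A → ℝ} (hg : Continuous g)
    (hg' : Continuous g') (h : ∀ a, (g a : UnitAddCircle) = g' a) (a b : A) :
    g b - g a = g' b - g' a := by
  obtain ⟨k, hk⟩ := exists_int_sub_eq hg hg' h
  linarith [hk a, hk b]

end Winding

section Homology

variable {Y : Type v} [TopologicalSpace Y]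

instance stdSimplex_simplyConnectedSpace (n : ℕ) :
    SimplyConnectedSpace (stdSimplex ℝ (Fin (n + 1))) := by
  have := (convex_stdSimplex ℝ (Fin (n + 1))).contractibleSpace ⟨_, single_mem_stdSimplex ℝ 0⟩
  infer_instance

instance stdSimplex_locallyPathConnectedSpace (n : ℕ) :
    LocallyPathConnectedSpace (stdSimplex ℝ (Fin (n + 1))) :=
  (convex_stdSimplex ℝ (Fin (n + 1))).locallyPathConnectedSpace

/-- The variation of a map to the circle along a singular `1`-simplex. -/
def circleCochain (f : C(Y, UnitAddCircle))
    (σ : (TopCat.toSSet.obj (TopCat.of Y)).obj (Opposite.op (SimplexCategory.mk 1))) : ℝ :=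
  let g := (exists_real_lift (A := stdSimplex ℝ (Fin 2))
    (f.comp ((TopCat.of Y).toSSetObjEquiv _ σ))).choose
  g (stdSimplex.vertex 1) - g (stdSimplex.vertex 0)

lemma circleCochain_eq (f : C(Y, UnitAddCircle))
    (σ : (TopCat.toSSet.obj (TopCat.of Y)).obj (Opposite.op (SimplexCategory.mk 1)))
    {g : stdSimplex ℝ (Fin 2) → ℝ} (hg : Continuous g)
    (h : ∀ z, (g z : UnitAddCircle) = f ((TopCat.of Y).toSSetObjEquiv _ σ z)) :
    circleCochain f σ = g (stdSimplex.vertex 1) - g (stdSimplex.vertex 0) := by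
  let H := exists_real_lift (A := stdSimplex ℝ (Fin 2))
    (f.comp ((TopCat.of Y).toSSetObjEquiv _ σ))
  exact real_lift_sub_eq H.choose.continuous hg (fun a ↦ (H.choose_spec a).trans (h a).symm) _ _

lemma circleCochain_boundary (f : C(Y, UnitAddCircle))
    (τ : (TopCat.toSSet.obj (TopCat.of Y)).obj (Opposite.op (SimplexCategory.mk 2))) :
    circleCochain f ((TopCat.toSSet.obj (TopCat.of Y)).δ 0 τ)
      - circleCochain f ((TopCat.toSSet.obj (TopCat.of Y)).δ 1 τ)
      + circleCochain f ((TopCat.toSSet.obj (TopCat.of Y)).δ 2 τ) = 0 := by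
  obtain ⟨g, hg⟩ := exists_real_lift (A := stdSimplex ℝ (Fin 3))
    (f.comp ((TopCat.of Y).toSSetObjEquiv _ τ))
  have key (i : Fin 3) : circleCochain f ((TopCat.toSSet.obj (TopCat.of Y)).δ i τ) =
      g (stdSimplex.vertex (i.succAbove 1)) - g (stdSimplex.vertex (i.succAbove 0)) := by
    rw [circleCochain_eq f _ (g := fun z ↦ g (stdSimplex.map i.succAbove z))]
    · simp only [stdSimplex.map_vertex]
    · exact g.continuous.comp (stdSimplex.continuous_map _)
    · intro z
      rw [hg]
      exact congrArg f (TopCat.toSSetObjEquiv_δ_apply (X := TopCat.of Y) τ i z).symm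
  rw [key, key, key]
  have h00 : (0 : Fin 3).succAbove (0 : Fin 2) = 1 := rfl
  have h01 : (0 : Fin 3).succAbove (1 : Fin 2) = 2 := rfl
  have h10 : (1 : Fin 3).succAbove (0 : Fin 2) = 0 := rfl
  have h11 : (1 : Fin 3).succAbove (1 : Fin 2) = 2 := rfl
  have h20 : (2 : Fin 3).succAbove (0 : Fin 2) = 0 := rfl
  have h21 : (2 : Fin 3).succAbove (1 : Fin 2) = 1 := rfl
  rw [h00, h01, h10, h11, h20, h21]
  ring

/-- The homomorphism `ℤ → ℝ` with value `r` at `1`, between lifts to the universe `v`. -/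
def intToReal (r : ℝ) : intCoeff.{v} ⟶ AddCommGrpCat.of (ULift.{v} ℝ) :=
  AddCommGrpCat.ofHom
    { toFun := fun m ↦ ⟨m.down • r⟩
      map_zero' := by ext; simp
      map_add' := fun a b ↦ by ext; simp [add_mul] }

lemma intToReal_add (r s : ℝ) : intToReal.{v} (r + s) = intToReal r + intToReal s := by
  ext x
  exact smul_add (ULift.down x : ℤ) r s

/-- The variation of a map to the circle, as a homomorphism on singular `1`-chains. -/
def circleCochainHom (f : C(Y, UnitAddCircle)) :
    ((TopCat.toSSet.obj (TopCat.of Y)).chainComplex intCoeff.{v}).X 1 ⟶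
      AddCommGrpCat.of (ULift.{v} ℝ) :=
  Limits.Sigma.desc fun σ ↦ intToReal (circleCochain f σ)

lemma ι_circleCochainHom (f : C(Y, UnitAddCircle))
    (σ : (TopCat.toSSet.obj (TopCat.of Y)).obj (Opposite.op (SimplexCategory.mk 1))) :
    (TopCat.toSSet.obj (TopCat.of Y)).ιChainComplex (R := intCoeff.{v}) σ ≫ circleCochainHom f =
      intToReal (circleCochain f σ) :=
  Limits.Sigma.ι_desc _ _

lemma d_circleCochainHom (f : C(Y, UnitAddCircle)) :
    ((TopCat.toSSet.obj (TopCat.of Y)).chainComplex intCoeff.{v}).d 2 1 ≫ circleCochainHom f = 0 := by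
  refine SSet.chainComplex_hom_ext fun τ ↦ ?_
  rw [SSet.ιChainComplex_d_assoc, Fin.sum_univ_three]
  simp only [Preadditive.add_comp, Preadditive.zsmul_comp, Limits.comp_zero,
    ι_circleCochainHom]
  have h : ∀ a b c : ℝ, a - b + c = 0 →
      ((-1 : ℤ) ^ (0 : Fin 3).val • intToReal a + (-1 : ℤ) ^ (1 : Fin 3).val • intToReal b) +
        (-1 : ℤ) ^ (2 : Fin 3).val • intToReal.{v} c = 0 := by
    intro a b c habc
    obtain rfl : b = a + c := by linarith
    rw [intToReal_add]
    simp
  exact h _ _ _ (circleCochain_boundary f τ)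

/-- The homomorphism on `H₁` given by a map to the circle. -/
def circleH1 (f : C(Y, UnitAddCircle)) : H1 Y ⟶ AddCommGrpCat.of (ULift.{v} ℝ) :=
  ((TopCat.toSSet.obj (TopCat.of Y)).chainComplex intCoeff.{v}).homologyι 1 ≫
    ((TopCat.toSSet.obj (TopCat.of Y)).chainComplex intCoeff.{v}).descOpcycles
      (circleCochainHom f) 2 (by simp) (d_circleCochainHom f)

lemma circleH1_loopClass (f : C(Y, UnitAddCircle)) {e : Y} (α : Path e e) {g : unitInterval → ℝ}
    (hg : Continuous g) (h : ∀ t, (g t : UnitAddCircle) = f (α t)) :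
    (circleH1 f (loopClass α)).down = g 1 - g 0 := by
  have h1 : circleCochain f (loopSimplex α) = g 1 - g 0 := by
    rw [circleCochain_eq f _ (g := fun z ↦ g (stdSimplexHomeomorphUnitInterval z))]
    · rfl
    · exact hg.comp (Homeomorph.continuous _)
    · intro z
      rw [h]
      rfl
  have h2 : circleH1 f (loopClass α) = intToReal (circleCochain f (loopSimplex α)) (ULift.up 1) := by
    have h3 : (((TopCat.toSSet.obj (TopCat.of Y)).chainComplex intCoeff.{v}).liftCycles
        ((TopCat.toSSet.obj (TopCat.of Y)).ιChainComplex (R := intCoeff.{v}) (loopSimplex α)) 0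
        (by simp) (loopSimplex_boundary α) ≫
        ((TopCat.toSSet.obj (TopCat.of Y)).chainComplex intCoeff.{v}).homologyπ 1) ≫
        ((TopCat.toSSet.obj (TopCat.of Y)).chainComplex intCoeff.{v}).homologyι 1 ≫
        ((TopCat.toSSet.obj (TopCat.of Y)).chainComplex intCoeff.{v}).descOpcycles
          (circleCochainHom f) 2 (by simp) (d_circleCochainHom f) =
        intToReal (circleCochain f (loopSimplex α)) := by
      simp [ι_circleCochainHom]
    exact congrArg (fun φ : intCoeff.{v} ⟶ AddCommGrpCat.of (ULift.{v} ℝ) ↦ φ (ULift.up 1)) h3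
  rw [h2, h1]
  simp [intToReal]

lemma toSSet_map_loopSimplex {e : Y} (α : Path e e) (F : C(Y, Y)) :
    (TopCat.toSSet.map (TopCat.ofHom F)).app _ (loopSimplex α) =
      loopSimplex (α.map F.continuous) :=
  rfl

lemma H1map_loopClass {e : Y} (α : Path e e) (F : C(Y, Y)) :
    H1map F (loopClass α) = loopClass (α.map F.continuous) := by
  have h : (((TopCat.toSSet.obj (TopCat.of Y)).chainComplex intCoeff.{v}).liftCycles
        ((TopCat.toSSet.obj (TopCat.of Y)).ιChainComplex (R := intCoeff.{v}) (loopSimplex α)) 0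
        (by simp) (loopSimplex_boundary α) ≫
        ((TopCat.toSSet.obj (TopCat.of Y)).chainComplex intCoeff.{v}).homologyπ 1) ≫
        HomologicalComplex.homologyMap
          (SSet.chainComplexMap (TopCat.toSSet.map (TopCat.ofHom F)) intCoeff.{v}) 1 =
      ((TopCat.toSSet.obj (TopCat.of Y)).chainComplex intCoeff.{v}).liftCycles
        ((TopCat.toSSet.obj (TopCat.of Y)).ιChainComplex (R := intCoeff.{v})
          (loopSimplex (α.map F.continuous))) 0
        (by simp) (loopSimplex_boundary (α.map F.continuous)) ≫
        ((TopCat.toSSet.obj (TopCat.of Y)).chainComplex intCoeff.{v}).homologyπ 1 := by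
    simp only [Category.assoc, HomologicalComplex.homologyπ_naturality,
      HomologicalComplex.liftCycles_comp_cyclesMap_assoc]
    congr 2
    rw [SSet.ι_chainComplexMap_f, toSSet_map_loopSimplex]
  exact congrArg (fun φ : intCoeff.{v} ⟶ H1 Y ↦ φ (ULift.up 1)) h

end Homology

section LinearAlgebra

lemma pow_apply_eq_add_nsmul {M : Type*} [AddCommGroup M] [Module ℚ M] (t : Module.End ℚ M) {v : M}
    (h : (t - 1) ((t - 1) v) = 0) (n : ℕ) : (t ^ n) v = v + n • (t - 1) v := by
  induction n with
  | zero => simp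
  | succ n ih =>
    have h' : t ((t - 1) v) = (t - 1) v := by
      rwa [LinearMap.sub_apply, Module.End.one_apply, sub_eq_zero] at h
    have h'' : t v = v + (t - 1) v := by simp
    rw [pow_succ', Module.End.mul_apply, ih, map_add, map_nsmul, h', succ_nsmul, h'']
    abel

lemma sub_one_apply_eq_zero {M : Type*} [AddCommGroup M] [Module ℚ M] {t : Module.End ℚ M} {d : ℕ}
    (hd : d ≠ 0) (ht : t ^ d = 1) {v : M} (h : (t - 1) ((t - 1) v) = 0) : (t - 1) v = 0 := by
  have := pow_apply_eq_add_nsmul t h d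
  rw [ht, Module.End.one_apply, left_eq_add, ← Nat.cast_smul_eq_nsmul ℚ, smul_eq_zero] at this
  simpa [hd] using this

variable {M M' M'' : Type*} [AddCommGroup M] [Module ℚ M] [AddCommGroup M'] [Module ℚ M']
  [AddCommGroup M''] [Module ℚ M'']

/-- If the kernel of an equivariant map `A` is larger, on the nontrivial isotypic part, than the
source of an equivariant map `B`, then some `t w - w` with `A w = 0` is not in the range of `B`. -/
lemma exists_mem_ker_sub_notMem_range [FiniteDimensional ℚ M] [FiniteDimensional ℚ M']
    [FiniteDimensional ℚ M''] {t : Module.End ℚ M} {t' : Module.End ℚ M'} {t'' : Module.End ℚ M''}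
    {d : ℕ} (hd : d ≠ 0) (ht : t ^ d = 1) {A : M →ₗ[ℚ] M'} {B : M'' →ₗ[ℚ] M}
    (hA : ∀ w, A (t w) = t' (A w)) (hB : ∀ u, B (t'' u) = t (B u))
    (hr : Module.finrank ℚ (LinearMap.range (t' - 1)) + Module.finrank ℚ (LinearMap.range (t'' - 1)) <
      Module.finrank ℚ (LinearMap.range (t - 1))) :
    ∃ w, A w = 0 ∧ (t - 1) w ∉ LinearMap.range B := by
  by_contra! h
  set R := LinearMap.range (t - 1) with hR
  set N := LinearMap.ker A ⊓ R with hN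
  have hmaps : ∀ w ∈ N, (t - 1) w ∈ N := fun w hw ↦
    ⟨by simp [hA, LinearMap.mem_ker.1 hw.1], LinearMap.mem_range_self _ _⟩
  have hinj : Function.Injective ((t - 1).restrict hmaps) := by
    rw [← LinearMap.ker_eq_bot, LinearMap.ker_eq_bot']
    rintro ⟨w, hw⟩ hw0
    obtain ⟨v, rfl⟩ := hw.2
    exact Subtype.ext (sub_one_apply_eq_zero hd ht (congrArg Subtype.val hw0))
  have hsurj := LinearMap.injective_iff_surjective.1 hinj
  have hle : N ≤ (LinearMap.range (t'' - 1)).map B := by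
    intro w hw
    obtain ⟨⟨w', hw'⟩, h'⟩ := hsurj ⟨w, hw⟩
    obtain ⟨⟨w'', hw''⟩, h''⟩ := hsurj ⟨w', hw'⟩
    obtain ⟨u, hu⟩ := h w'' hw''.1
    have e' : (t - 1) w' = w := congrArg Subtype.val h'
    have e'' : (t - 1) w'' = w' := congrArg Subtype.val h''
    refine ⟨(t'' - 1) u, ⟨u, rfl⟩, ?_⟩
    rw [← e', ← e'', ← hu]
    simp [hB]
  have h1 : Module.finrank ℚ N ≤ Module.finrank ℚ (LinearMap.range (t'' - 1)) :=
    (Submodule.finrank_mono hle).trans (Submodule.finrank_map_le _ _)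
  have h2 := (A.domRestrict R).finrank_range_add_finrank_ker
  have h3 : LinearMap.range (A.domRestrict R) ≤ LinearMap.range (t' - 1) := by
    rintro _ ⟨⟨_, v, rfl⟩, rfl⟩
    exact ⟨A v, by simp [hA]⟩
  have h4 := Submodule.finrank_mono h3
  have h5 : Module.finrank ℚ (LinearMap.ker (A.domRestrict R)) = Module.finrank ℚ N := by
    have : N = (LinearMap.ker (A.domRestrict R)).map R.subtype := by
      ext x
      simp [hN, and_comm]
    rw [this]
    exact (LinearEquiv.finrank_eq
      (Submodule.equivMapOfInjective _ R.injective_subtype _))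
  omega

lemma finrank_range_compLeft [FiniteDimensional ℚ M] (f : M →ₗ[ℚ] M) (ι : Type*) [Fintype ι] :
    Module.finrank ℚ (LinearMap.range (f.compLeft ι)) =
      Fintype.card ι * Module.finrank ℚ (LinearMap.range f) := by
  have h : LinearMap.range (f.compLeft ι) =
      LinearMap.range ((LinearMap.range f).subtype.compLeft ι) := by
    ext v
    constructor
    · rintro ⟨w, rfl⟩
      exact ⟨fun i ↦ ⟨f (w i), w i, rfl⟩, rfl⟩
    · rintro ⟨w, rfl⟩
      choose u hu using fun i ↦ (w i).2
      exact ⟨u, funext hu⟩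
  rw [h, LinearMap.finrank_range_of_inj, Module.finrank_pi_fintype]
  · simp
  · intro a b hab
    funext i
    exact Subtype.ext (congrFun hab i)

lemma finrank_range_compLeft_sub_one [FiniteDimensional ℚ M] (s : Module.End ℚ M) (ι : Type*)
    [Fintype ι] :
    Module.finrank ℚ (LinearMap.range (s.compLeft ι - 1 : Module.End ℚ (ι → M))) =
      Fintype.card ι * Module.finrank ℚ (LinearMap.range (s - 1)) := by
  have h : (s.compLeft ι - 1 : Module.End ℚ (ι → M)) = (s - 1).compLeft ι := by
    ext1 v
    rfl
  rw [h, finrank_range_compLeft]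

lemma exists_common_denominator {α : Type*} [Finite α] (w : α → ℚ) :
    ∃ D : ℕ, D ≠ 0 ∧ ∃ z : α → ℤ, ∀ a, (z a : ℚ) = D * w a := by
  have := Fintype.ofFinite α
  refine ⟨∏ a, (w a).den, Finset.prod_ne_zero_iff.2 fun a _ ↦ (w a).den_nz, ?_⟩
  have key (a : α) : ∃ z : ℤ, (z : ℚ) = (∏ b, (w b).den : ℕ) * w a := by
    obtain ⟨c, hc⟩ := Finset.dvd_prod_of_mem (fun b ↦ (w b).den) (Finset.mem_univ a)
    refine ⟨c * (w a).num, ?_⟩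
    rw [hc]
    push_cast
    rw [mul_right_comm, Rat.den_mul_eq_num]
    ring
  choose z hz using key
  exact ⟨z, hz⟩

/-- An integral version of `exists_mem_ker_sub_notMem_range` for spaces of functions on copies of a
finite set with a nontrivial permutation. -/
lemma exists_int_cochain {X ι κ τ : Type*} [Finite X] [Fintype ι] [Fintype κ] [Fintype τ]
    {T : X → X} {d : ℕ} (hd : d ≠ 0) (hTd : T^[d] = id) (hT : T ≠ id)
    (A : (ι → X → ℚ) →ₗ[ℚ] (κ → X → ℚ)) (B : (τ → X → ℚ) →ₗ[ℚ] (ι → X → ℚ))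
    (hA : ∀ w, A (fun i x ↦ w i (T x)) = fun k x ↦ A w k (T x))
    (hB : ∀ w, B (fun i x ↦ w i (T x)) = fun k x ↦ B w k (T x))
    (hcard : Fintype.card κ + Fintype.card τ < Fintype.card ι) :
    ∃ w : ι → X → ℤ, A (fun i x ↦ (w i x : ℚ)) = 0 ∧
      ∀ u, B u ≠ fun i x ↦ ((w i (T x) : ℚ) - w i x) := by
  let s : Module.End ℚ (X → ℚ) := LinearMap.funLeft ℚ ℚ T
  have hs0 : s - 1 ≠ 0 := by
    intro h0
    obtain ⟨x, hx⟩ := Function.ne_iff.1 hT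
    classical
    have := congrFun (LinearMap.congr_fun h0 (Pi.single x 1)) x
    simp [s, LinearMap.funLeft_apply, show T x ≠ x from hx] at this
  have hr : 0 < Module.finrank ℚ (LinearMap.range (s - 1)) :=
    Nat.pos_of_ne_zero fun h ↦ hs0 (LinearMap.range_eq_bot.1 (Submodule.finrank_eq_zero.1 h))
  have hpow : (s.compLeft ι : Module.End ℚ (ι → X → ℚ)) ^ d = 1 := by
    have (n : ℕ) (v : ι → X → ℚ) :
        ((s.compLeft ι : Module.End ℚ (ι → X → ℚ)) ^ n) v = fun i x ↦ v i (T^[n] x) := by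
      induction n generalizing v with
      | zero => rfl
      | succ n ih => rw [pow_succ, Module.End.mul_apply, ih]; simp only [Function.iterate_succ_apply']; rfl
    ext1 v
    simp [this, hTd]
  obtain ⟨w, hw, hwB⟩ := exists_mem_ker_sub_notMem_range (t := s.compLeft ι) (t' := s.compLeft κ)
    (t'' := s.compLeft τ) hd hpow (A := A) (B := B) hA hB (by
      rw [finrank_range_compLeft_sub_one, finrank_range_compLeft_sub_one,
        finrank_range_compLeft_sub_one, ← add_mul]
      exact Nat.mul_lt_mul_of_pos_right hcard hr)
  obtain ⟨D, hD, z, hz⟩ := exists_common_denominator fun a : ι × X ↦ w a.1 a.2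
  have hzw : (fun i x ↦ (z (i, x) : ℚ)) = (D : ℚ) • w := by
    funext i x
    simp [hz]
  refine ⟨fun i x ↦ z (i, x), by rw [hzw, map_smul, hw, smul_zero], fun u hu ↦ hwB ?_⟩
  refine ⟨(D : ℚ)⁻¹ • u, ?_⟩
  rw [map_smul, hu]
  funext i x
  have hD' : (D : ℚ) ≠ 0 := by exact_mod_cast hD
  simp only [Pi.smul_apply, hz, smul_eq_mul]
  rw [← mul_sub, inv_mul_cancel_left₀ hD']
  rfl

end LinearAlgebra

section WindingOfPaths

variable {Y : Type*} [TopologicalSpace Y]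

instance unitInterval_simplyConnectedSpace : SimplyConnectedSpace unitInterval := by
  have := (convex_Icc (0 : ℝ) 1).contractibleSpace ⟨0, by simp⟩
  exact inferInstanceAs (SimplyConnectedSpace (Set.Icc (0 : ℝ) 1))

instance unitInterval_locallyPathConnectedSpace : LocallyPathConnectedSpace unitInterval :=
  (convex_Icc (0 : ℝ) 1).locallyPathConnectedSpace

/-- The total variation of a map to the circle along a path. -/
def winding (f : C(Y, UnitAddCircle)) {a b : Y} (c : Path a b) : ℝ :=
  let g := (exists_real_lift (f.comp c.toContinuousMap)).choose
  g 1 - g 0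

lemma winding_eq (f : C(Y, UnitAddCircle)) {a b : Y} (c : Path a b) {g : unitInterval → ℝ}
    (hg : Continuous g) (h : ∀ t, (g t : UnitAddCircle) = f (c t)) : winding f c = g 1 - g 0 := by
  let H := exists_real_lift (f.comp c.toContinuousMap)
  exact real_lift_sub_eq H.choose.continuous hg (fun t ↦ (H.choose_spec t).trans (h t).symm) _ _

lemma winding_trans (f : C(Y, UnitAddCircle)) {a b c : Y} (γ : Path a b) (γ' : Path b c) :
    winding f (γ.trans γ') = winding f γ + winding f γ' := by
  obtain ⟨g, hg⟩ := exists_real_lift (f.comp (γ.trans γ').toContinuousMap)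
  have hfst (t : unitInterval) : (t : ℝ) / 2 ∈ unitInterval :=
    ⟨by linarith [t.2.1], by linarith [t.2.2]⟩
  have hsnd (t : unitInterval) : ((t : ℝ) + 1) / 2 ∈ unitInterval :=
    ⟨by linarith [t.2.1], by linarith [t.2.2]⟩
  have h1 : winding f γ = g ⟨_, hfst 1⟩ - g ⟨_, hfst 0⟩ := by
    refine winding_eq f γ (g := fun t ↦ g ⟨_, hfst t⟩) (by fun_prop) fun t ↦ ?_
    rw [hg]
    have : (t : ℝ) / 2 ≤ 1 / 2 := by linarith [t.2.2]
    refine congrArg f ((Path.trans_apply _ _ _).trans ?_)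
    rw [dif_pos this]
    exact congrArg γ (Subtype.ext (by simp; ring))
  have h2 : winding f γ' = g ⟨_, hsnd 1⟩ - g ⟨_, hsnd 0⟩ := by
    refine winding_eq f γ' (g := fun t ↦ g ⟨_, hsnd t⟩) (by fun_prop) fun t ↦ ?_
    rw [hg]
    have : (((t : ℝ) + 1) / 2) = 1 / 2 + t / 2 := by ring
    refine congrArg f ((Path.trans_apply _ _ _).trans ?_)
    split_ifs with h
    · have ht : (t : ℝ) ≤ 0 := by
        change ((t : ℝ) + 1) / 2 ≤ 1 / 2 at h
        linarith
      obtain rfl : t = 0 := Subtype.ext (le_antisymm ht t.2.1)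
      simp
    · exact congrArg γ' (Subtype.ext (by simp; ring))
  have h3 := winding_eq f (γ.trans γ') g.continuous hg
  have e1 : (⟨_, hfst 1⟩ : unitInterval) = ⟨_, hsnd 0⟩ := Subtype.ext (by simp)
  have e2 : (⟨_, hsnd 1⟩ : unitInterval) = 1 := Subtype.ext (by simp)
  have e3 : (⟨_, hfst 0⟩ : unitInterval) = 0 := Subtype.ext (by simp)
  rw [h1, h2, h3, e1, e2, e3]
  ring

lemma winding_symm (f : C(Y, UnitAddCircle)) {a b : Y} (γ : Path a b) :
    winding f γ.symm = - winding f γ := by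
  obtain ⟨g, hg⟩ := exists_real_lift (f.comp γ.toContinuousMap)
  rw [winding_eq f γ g.continuous hg,
    winding_eq f γ.symm (g := fun t ↦ g (unitInterval.symm t)) (by fun_prop) fun t ↦ hg _]
  simp

lemma winding_conj (f : C(Y, UnitAddCircle)) {a b : Y} (c : Path a b) (γ : Path b b) :
    winding f ((c.trans γ).trans c.symm) = winding f γ := by
  rw [winding_trans, winding_trans, winding_symm]
  ring

lemma winding_map (f : C(Y, UnitAddCircle)) (T : C(Y, Y)) {a b : Y} (c : Path a b) :
    winding f (c.map T.continuous) = winding (f.comp T) c := by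
  obtain ⟨g, hg⟩ := exists_real_lift ((f.comp T).comp c.toContinuousMap)
  rw [winding_eq (f.comp T) c g.continuous hg, winding_eq f (c.map T.continuous) g.continuous hg]

lemma winding_sub (f f' : C(Y, UnitAddCircle)) {a b : Y} (c : Path a b) :
    winding (f - f') c = winding f c - winding f' c := by
  obtain ⟨g, hg⟩ := exists_real_lift (f.comp c.toContinuousMap)
  obtain ⟨g', hg'⟩ := exists_real_lift (f'.comp c.toContinuousMap)
  rw [winding_eq f c g.continuous hg, winding_eq f' c g'.continuous hg',
    winding_eq (f - f') c (g := fun t ↦ g t - g' t) (by fun_prop) fun t ↦ by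
      rw [AddCircle.coe_sub, hg, hg']; rfl]
  ring

lemma winding_eq_of_loopClass_eq {f : C(Y, UnitAddCircle)} {e e' : Y} {α : Path e e} {β : Path e' e'}
    (h : loopClass α = loopClass β) : winding f α = winding f β := by
  obtain ⟨g, hg⟩ := exists_real_lift (f.comp α.toContinuousMap)
  obtain ⟨g', hg'⟩ := exists_real_lift (f.comp β.toContinuousMap)
  rw [winding_eq f α g.continuous hg, winding_eq f β g'.continuous hg',
    ← circleH1_loopClass f α g.continuous hg, h, circleH1_loopClass f β g'.continuous hg']

end WindingOfPaths

section LiftingCriterion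

variable {E X A : Type*} [TopologicalSpace E] [TopologicalSpace X] [TopologicalSpace A]
  [PathConnectedSpace A] [LocallyPathConnectedSpace A]

lemma IsCoveringMap.exists_lift_of_loops {p : C(E, X)} (cov : IsCoveringMap p) (h : C(A, X))
    {a₀ : A} {e₀ : E} (he : p e₀ = h a₀)
    (H : ∀ α : Path a₀ a₀, ∃ β : Path e₀ e₀,
      (p.comp β.toContinuousMap).HomotopicRel (h.comp α.toContinuousMap) {0, 1}) :
    ∃ F : C(A, E), F a₀ = e₀ ∧ ∀ a, p (F a) = h a := by
  obtain ⟨F, ⟨hF, hF'⟩, -⟩ := cov.existsUnique_continuousMap_lifts_of_range_le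
    (f := h) he (by
      rintro _ ⟨x, rfl⟩
      obtain ⟨α, rfl⟩ := Path.Homotopic.Quotient.mk_surjective x
      obtain ⟨β, hβ⟩ := H α
      refine ⟨FundamentalGroup.fromPath (.mk β), ?_⟩
      rw [FundamentalGroup.mapOfEq_apply]
      exact Path.Homotopic.Quotient.eq.2 hβ)
  exact ⟨F, hF, congrFun hF'⟩

/-- A map to the circle with trivial winding numbers lifts to the real line. -/
lemma exists_real_lift_of_winding (h : C(A, UnitAddCircle)) (a₀ : A)
    (H : ∀ α : Path a₀ a₀, winding h α = 0) :
    ∃ u : C(A, ℝ), ∀ a, (u a : UnitAddCircle) = h a := by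
  obtain ⟨r, hr⟩ := QuotientAddGroup.mk_surjective (h a₀)
  obtain ⟨F, -, hF⟩ := UnitAddCircle.isCoveringMap_coe.exists_lift_of_loops
    (p := ⟨_, UnitAddCircle.isCoveringMap_coe.continuous⟩) h (a₀ := a₀) (e₀ := r) hr fun α ↦ by
      obtain ⟨g, hg⟩ := exists_real_lift (h.comp α.toContinuousMap)
      have h0 : g 1 - g 0 = 0 := by rw [← winding_eq h α g.continuous hg, H]
      have hg0 : (g 0 : UnitAddCircle) = r := by
        rw [hg 0]
        simpa using hr.symm
      obtain ⟨k, hk⟩ := UnitAddCircle.coe_eq_coe_iff.1 hg0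
      refine ⟨⟨⟨fun t ↦ g t - k, by fun_prop⟩, by simp [← hk], ?_⟩, ?_⟩
      · simp only [← hk]
        linarith
      · have : (ContinuousMap.comp ⟨((↑) : ℝ → UnitAddCircle),
            UnitAddCircle.isCoveringMap_coe.continuous⟩ ⟨fun t ↦ g t - k, by fun_prop⟩) =
            h.comp α.toContinuousMap := by
          ext t
          refine Eq.trans ?_ (hg t)
          exact UnitAddCircle.coe_eq_coe_iff.2 ⟨-k, by
            change g t - k - g t = _
            push_cast
            ring⟩
        exact this ▸ ContinuousMap.HomotopicRel.refl _
  exact ⟨F, hF⟩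

end LiftingCriterion

section ProjectedPaths

variable {Y S : Type*} [TopologicalSpace Y] [TopologicalSpace S] {x₀ : S}

/-- The class in `π₁(S, x₀)` of the projection of a path between points over `x₀`. -/
def projClass (p : C(Y, S)) {a b : Y} (ha : p a = x₀) (hb : p b = x₀) (c : Path a b) :
    FundamentalGroup S x₀ :=
  FundamentalGroup.fromPath (.mk ((c.map p.continuous).cast ha.symm hb.symm))

variable {p : C(Y, S)} {a b c : Y} {ha : p a = x₀} {hb : p b = x₀} {hc : p c = x₀}

lemma projClass_eq_iff {a' b' : Y} {ha' : p a' = x₀} {hb' : p b' = x₀} {γ : Path a b}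
    {γ' : Path a' b'} : projClass p ha hb γ = projClass p ha' hb' γ' ↔
      (p.comp γ.toContinuousMap).HomotopicRel (p.comp γ'.toContinuousMap) {0, 1} :=
  Path.Homotopic.Quotient.eq

lemma projClass_trans (γ : Path a b) (γ' : Path b c) :
    projClass p ha hc (γ.trans γ') = projClass p hb hc γ' * projClass p ha hb γ := by
  rw [FundamentalGroup.mul_def]
  refine congrArg Path.Homotopic.Quotient.mk (?_ : _ = Path.trans _ _)
  rw [Path.map_trans]
  rfl

lemma projClass_symm (γ : Path a b) :
    projClass p hb ha γ.symm = (projClass p ha hb γ)⁻¹ :=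
  rfl

lemma mapOfEq_fromPath (γ : Path a a) :
    FundamentalGroup.mapOfEq p ha (FundamentalGroup.fromPath (.mk γ)) = projClass p ha ha γ := by
  rw [FundamentalGroup.mapOfEq_apply]
  rfl

lemma IsCoveringMap.exists_projClass_eq (cov : IsCoveringMap p) (ha : p a = x₀)
    (γ : FundamentalGroup S x₀) :
    ∃ (b : Y) (hb : p b = x₀) (c : Path a b), projClass p ha hb c = γ := by
  obtain ⟨γ, rfl⟩ := Path.Homotopic.Quotient.mk_surjective γ
  obtain ⟨Γ, hΓ, hΓ0⟩ := cov.exists_path_lifts γ.toContinuousMap a (by simp [ha])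
  refine ⟨Γ 1, by simpa using congrFun hΓ 1, ⟨Γ, hΓ0, rfl⟩, ?_⟩
  refine congrArg Path.Homotopic.Quotient.mk ?_
  ext t
  exact congrFun hΓ t

end ProjectedPaths

section AssociatedCover

variable {Y S : Type*} [TopologicalSpace Y] [TopologicalSpace S] {x₀ : S}
  {K : Subgroup (FundamentalGroup S x₀)} {p : C(Y, S)} {e : Y} {he : p e = x₀}

lemma IsAssociatedCover.projClass_mem (hp : IsAssociatedCover K p e he) (α : Path e e) :
    projClass p he he α ∈ K := by
  rw [← hp.range_eq, ← mapOfEq_fromPath]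
  exact ⟨_, rfl⟩

lemma IsAssociatedCover.exists_projClass_eq (hp : IsAssociatedCover K p e he)
    {k : FundamentalGroup S x₀} (hk : k ∈ K) : ∃ α : Path e e, projClass p he he α = k := by
  rw [← hp.range_eq] at hk
  obtain ⟨x, rfl⟩ := hk
  obtain ⟨α, rfl⟩ := Path.Homotopic.Quotient.mk_surjective x
  exact ⟨α, (mapOfEq_fromPath α).symm⟩

lemma IsAssociatedCover.of_mem_fiber [K.Normal] (hp : IsAssociatedCover K p e he) {a : Y}
    (ha : p a = x₀) : IsAssociatedCover K p a ha where
  covering := hp.covering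
  connected := hp.connected
  range_eq := by
    have := hp.connected
    let c : Path e a := PathConnectedSpace.somePath e a
    ext k
    constructor
    · rintro ⟨x, rfl⟩
      obtain ⟨α, rfl⟩ := Path.Homotopic.Quotient.mk_surjective x
      have h := hp.projClass_mem ((c.trans α).trans c.symm)
      rw [projClass_trans (hb := ha), projClass_trans (hb := ha), projClass_symm (ha := he)] at h
      rw [show _ = projClass p ha ha α from mapOfEq_fromPath α]
      have h' := Subgroup.Normal.conj_mem ‹_› _ h (projClass p he ha c)
      convert h' using 1
      group
    · intro hk
      have h := Subgroup.Normal.conj_mem' ‹_› _ hk (projClass p he ha c)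
      obtain ⟨α, hα⟩ := hp.exists_projClass_eq h
      refine ⟨FundamentalGroup.fromPath (.mk ((c.symm.trans α).trans c)), ?_⟩
      rw [mapOfEq_fromPath, projClass_trans (hb := he), projClass_trans (hb := he),
        projClass_symm (ha := he), hα]
      group

lemma IsAssociatedCover.exists_deck [K.Normal] [LocallyPathConnectedSpace Y]
    (hp : IsAssociatedCover K p e he) {a b : Y} (ha : p a = x₀) (hb : p b = x₀) :
    ∃ T : C(Y, Y), T a = b ∧ ∀ y, p (T y) = p y := by
  have := hp.connected
  refine hp.covering.exists_lift_of_loops p (hb.trans ha.symm) fun α ↦ ?_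
  obtain ⟨β, hβ⟩ := (hp.of_mem_fiber hb).exists_projClass_eq ((hp.of_mem_fiber ha).projClass_mem α)
  exact ⟨β, projClass_eq_iff.1 hβ⟩

lemma IsAssociatedCover.eq_of_apply_eq (hp : IsAssociatedCover K p e he) {A : Type*}
    [TopologicalSpace A] [PreconnectedSpace A] {F F' : C(A, Y)} (h : ∀ a, p (F a) = p (F' a)) {a : A}
    (ha : F a = F' a) : F = F' :=
  DFunLike.coe_injective (hp.covering.eq_of_comp_eq F.continuous F'.continuous (funext h) a ha)

end AssociatedCover

section Reduction

variable {Y S : Type*} [TopologicalSpace Y] [TopologicalSpace S] {x₀ : S}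
  {K : Subgroup (FundamentalGroup S x₀)} {p : C(Y, S)} {e : Y} {he : p e = x₀}

lemma apply_mem_of_characteristic {G : Type*} [Group G] {K : Subgroup G} [K.Characteristic]
    (ψ : G ≃* G) {k : G} (hk : k ∈ K) : ψ k ∈ K := by
  have h : K.map ψ.toMonoidHom = K := Subgroup.characteristic_iff_map_eq.1 ‹_› ψ
  rw [← h]
  exact ⟨k, hk, rfl⟩

lemma exists_inv_mul_notMem {G : Type*} [Group G] {K : Subgroup G} [K.Characteristic] {ψ : G ≃* G}
    (hψ : inducedAut K ψ ≠ MulEquiv.refl _) : ∃ γ : G, γ⁻¹ * ψ γ ∉ K := by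
  by_contra! h
  refine hψ (MulEquiv.ext fun x ↦ ?_)
  obtain ⟨γ, rfl⟩ := QuotientGroup.mk_surjective x
  exact (QuotientGroup.eq.2 (h γ)).symm

/-- If `ψ` acts trivially on the winding numbers of loops in the cover, then there is a nontrivial
deck transformation `T` acting trivially on homotopy classes of maps to the circle. -/
lemma IsAssociatedCover.exists_deck_of_winding_eq [K.Characteristic] [LocallyPathConnectedSpace Y]
    (hp : IsAssociatedCover K p e he) {ψ : FundamentalGroup S x₀ ≃* FundamentalGroup S x₀}
    (hψ : inducedAut K ψ ≠ MulEquiv.refl _)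
    (H : ∀ α β : Path e e, projClass p he he β = ψ (projClass p he he α) →
      ∀ f : C(Y, UnitAddCircle), winding f α = winding f β) :
    ∃ T : C(Y, Y), (∀ y, p (T y) = p y) ∧ T ≠ ContinuousMap.id Y ∧
      ∀ f : C(Y, UnitAddCircle), ∃ u : C(Y, ℝ), ∀ y, (u y : UnitAddCircle) = f (T y) - f y := by
  have := hp.connected
  obtain ⟨γ, hγ⟩ := exists_inv_mul_notMem hψ
  obtain ⟨e₁, h₁, c₁, hc₁⟩ := hp.covering.exists_projClass_eq he γ
  obtain ⟨e₂, h₂, c₂, hc₂⟩ := hp.covering.exists_projClass_eq he (ψ γ)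
  obtain ⟨T₁, hT₁, hpT₁⟩ := hp.exists_deck he h₁
  obtain ⟨T₂, hT₂, hpT₂⟩ := hp.exists_deck he h₂
  obtain ⟨T, hT, hpT⟩ := hp.exists_deck h₁ h₂
  obtain ⟨T', hT', hpT'⟩ := hp.exists_deck h₁ he
  have hTT₁ : T.comp T₁ = T₂ :=
    hp.eq_of_apply_eq (a := e) (fun y ↦ by simp [hpT, hpT₁, hpT₂]) (by simp [hT₁, hT₂, hT])
  have hT₁T' : T₁.comp T' = ContinuousMap.id Y :=
    hp.eq_of_apply_eq (a := e₁) (fun y ↦ by simp [hpT₁, hpT']) (by simp [hT₁, hT'])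
  have hne : e₁ ≠ e₂ := by
    rintro rfl
    refine hγ ?_
    have h := hp.projClass_mem (c₂.trans c₁.symm)
    rwa [projClass_trans (hb := h₂), projClass_symm (ha := he), hc₁, hc₂] at h
  refine ⟨T, hpT, fun h ↦ hne (by rw [← hT, h]; rfl), fun f ↦ ?_⟩
  obtain ⟨u, hu⟩ := exists_real_lift_of_winding (f.comp T₂ - f.comp T₁) e fun α ↦ by
    obtain ⟨β, hβ⟩ := hp.exists_projClass_eq (apply_mem_of_characteristic ψ (hp.projClass_mem α))
    let α' : Path e₁ e₁ := (α.map T₁.continuous).cast hT₁.symm hT₁.symm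
    let β' : Path e₂ e₂ := (β.map T₂.continuous).cast hT₂.symm hT₂.symm
    have hα' : projClass p h₁ h₁ α' = projClass p he he α := by
      refine congrArg Path.Homotopic.Quotient.mk ?_
      ext t
      exact hpT₁ _
    have hβ' : projClass p h₂ h₂ β' = projClass p he he β := by
      refine congrArg Path.Homotopic.Quotient.mk ?_
      ext t
      exact hpT₂ _
    have key := H ((c₁.trans α').trans c₁.symm) ((c₂.trans β').trans c₂.symm) (by
      rw [projClass_trans (hb := h₁), projClass_trans (hb := h₁), projClass_symm (ha := he),
        projClass_trans (hb := h₂), projClass_trans (hb := h₂), projClass_symm (ha := he),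
        hα', hβ', hβ, hc₁, hc₂, map_mul, map_mul, map_inv]) f
    rw [winding_conj, winding_conj] at key
    have hwα : winding f α' = winding (f.comp T₁) α := winding_map f T₁ α
    have hwβ : winding f β' = winding (f.comp T₂) β := winding_map f T₂ β
    rw [winding_sub, ← hwα, key, hwβ, H α β hβ, sub_self]
  refine ⟨u.comp T', fun y ↦ ?_⟩
  have h1 : T₁ (T' y) = y := DFunLike.congr_fun hT₁T' y
  have h2 : T₂ (T' y) = T y := by
    rw [← hTT₁]
    exact congrArg T h1
  refine (hu (T' y)).trans ?_
  change f (T₂ (T' y)) - f (T₁ (T' y)) = _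
  rw [h1, h2]

lemma IsAssociatedCover.exists_lift_of_map_mem [LocallyPathConnectedSpace Y]
    (hp : IsAssociatedCover K p e he) {f : C(S, S)} (hf : f x₀ = x₀)
    (H : ∀ k ∈ K, FundamentalGroup.mapOfEq f hf k ∈ K) :
    ∃ F : C(Y, Y), F e = e ∧ ∀ y, p (F y) = f (p y) := by
  have := hp.connected
  refine hp.covering.exists_lift_of_loops (f.comp p) (by simp [he, hf]) fun α ↦ ?_
  obtain ⟨β, hβ⟩ := hp.exists_projClass_eq (H _ (hp.projClass_mem α))
  refine ⟨β, ?_⟩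
  rw [FundamentalGroup.mapOfEq_apply] at hβ
  exact Path.Homotopic.Quotient.eq.1 hβ

lemma IsAssociatedCover.existsUnique_isBasedLift [K.Characteristic] [LocallyPathConnectedSpace Y]
    (hp : IsAssociatedCover K p e he) {ψ : FundamentalGroup S x₀ ≃* FundamentalGroup S x₀}
    (f : S ≃ₜ S) (hf : f x₀ = x₀) (H : ∀ γ, FundamentalGroup.mapOfEq (f : C(S, S)) hf γ = ψ γ) :
    ∃! F : Y ≃ₜ Y, IsBasedLift p e f F := by
  have := hp.connected
  have hf' : f.symm x₀ = x₀ := by rw [Homeomorph.symm_apply_eq, hf]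
  have hsymm (γ) : FundamentalGroup.mapOfEq (f.symm : C(S, S)) hf' γ = ψ.symm γ := by
    rw [MulEquiv.eq_symm_apply, ← H, FundamentalGroup.mapOfEq_apply,
      FundamentalGroup.mapOfEq_apply]
    obtain ⟨γ, rfl⟩ := Path.Homotopic.Quotient.mk_surjective γ
    refine congrArg Path.Homotopic.Quotient.mk ?_
    ext t
    exact f.apply_symm_apply _
  obtain ⟨F, hF, hpF⟩ := hp.exists_lift_of_map_mem (f := f) hf fun k hk ↦ by
    rw [H]
    exact apply_mem_of_characteristic ψ hk
  obtain ⟨G, hG, hpG⟩ := hp.exists_lift_of_map_mem (f := f.symm) hf' fun k hk ↦ by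
    rw [hsymm]
    exact apply_mem_of_characteristic ψ.symm hk
  have hFG : F.comp G = ContinuousMap.id Y :=
    hp.eq_of_apply_eq (a := e) (fun y ↦ by simp [hpF, hpG]) (by simp [hF, hG])
  have hGF : G.comp F = ContinuousMap.id Y :=
    hp.eq_of_apply_eq (a := e) (fun y ↦ by simp [hpF, hpG]) (by simp [hF, hG])
  refine ⟨⟨⟨F, G, DFunLike.congr_fun hGF, DFunLike.congr_fun hFG⟩, F.continuous, G.continuous⟩,
    ⟨hpF, hF⟩, fun F' hF' ↦ ?_⟩
  have : (F' : C(Y, Y)) = F :=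
    hp.eq_of_apply_eq (a := e) (fun y ↦ (hF'.1 y).trans (hpF y).symm) (hF'.2.trans hF.symm)
  exact Homeomorph.ext fun y ↦ DFunLike.congr_fun this y

end Reduction

section SheetLift

variable {P S Y : Type*} [TopologicalSpace P] [TopologicalSpace S] [TopologicalSpace Y]
  [SimplyConnectedSpace P] [LocallyPathConnectedSpace P] {p : C(Y, S)} (cov : IsCoveringMap p)
  (q : C(P, S)) {z₀ : P} {x₀ : S} (hz₀ : q z₀ = x₀)

/-- The lift of a map `q : P → S` from a simply connected space through a covering map, starting at
a given point of the fibre. -/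
def sheetLift (x : p ⁻¹' {x₀}) : C(P, Y) :=
  (cov.existsUnique_continuousMap_lifts q z₀ x.1 (x.2.trans hz₀.symm)).choose

lemma sheetLift_base (x : p ⁻¹' {x₀}) : sheetLift cov q hz₀ x z₀ = x :=
  (cov.existsUnique_continuousMap_lifts q z₀ x.1 (x.2.trans hz₀.symm)).choose_spec.1.1

lemma apply_sheetLift (x : p ⁻¹' {x₀}) (z : P) : p (sheetLift cov q hz₀ x z) = q z :=
  congrFun (cov.existsUnique_continuousMap_lifts q z₀ x.1 (x.2.trans hz₀.symm)).choose_spec.1.2 z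

lemma eq_sheetLift {F : C(P, Y)} (hF : ∀ z, p (F z) = q z) {x : p ⁻¹' {x₀}} {z : P}
    (h : F z = sheetLift cov q hz₀ x z) : F = sheetLift cov q hz₀ x :=
  DFunLike.coe_injective (cov.eq_of_comp_eq F.continuous (sheetLift cov q hz₀ x).continuous
    (funext fun z ↦ (hF z).trans (apply_sheetLift cov q hz₀ x z).symm) z h)

variable {q} in
lemma sheetLift_injective {x x' : p ⁻¹' {x₀}} {z : P}
    (h : sheetLift cov q hz₀ x z = sheetLift cov q hz₀ x' z) : x = x' := by
  have := eq_sheetLift cov q hz₀ (apply_sheetLift cov q hz₀ x) h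
  refine Subtype.ext ?_
  rw [← sheetLift_base cov q hz₀ x, ← sheetLift_base cov q hz₀ x', this]

lemma exists_sheetLift_eq {z : P} {y : Y} (h : p y = q z) : ∃ x, sheetLift cov q hz₀ x z = y := by
  obtain ⟨F, ⟨hF, hpF⟩, -⟩ := cov.existsUnique_continuousMap_lifts q z y h
  have hF₀ : p (F z₀) = x₀ := (congrFun hpF z₀).trans hz₀
  refine ⟨⟨F z₀, hF₀⟩, ?_⟩
  rw [← eq_sheetLift cov q hz₀ (congrFun hpF) (sheetLift_base cov q hz₀ ⟨F z₀, hF₀⟩).symm, hF]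

lemma exists_sheet_transition {z z' : P} (h : q z = q z') :
    ∃ c : p ⁻¹' {x₀} → p ⁻¹' {x₀}, ∀ x, sheetLift cov q hz₀ (c x) z' = sheetLift cov q hz₀ x z := by
  choose c hc using fun x ↦ exists_sheetLift_eq cov q hz₀ (z := z')
    ((apply_sheetLift cov q hz₀ x z).trans h)
  exact ⟨c, hc⟩

/-- The action of a deck transformation on a fibre. -/
def fiberMap {p : C(Y, S)} (T : C(Y, Y)) (hT : ∀ y, p (T y) = p y) (x₀ : S) (x : p ⁻¹' {x₀}) :
    p ⁻¹' {x₀} :=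
  ⟨T x, (hT x).trans x.2⟩

variable {T : C(Y, Y)} (hT : ∀ y, p (T y) = p y)

lemma apply_sheetLift_deck (x : p ⁻¹' {x₀}) (z : P) :
    T (sheetLift cov q hz₀ x z) = sheetLift cov q hz₀ (fiberMap T hT x₀ x) z :=
  DFunLike.congr_fun (eq_sheetLift cov q hz₀ (F := T.comp (sheetLift cov q hz₀ x))
    (x := fiberMap T hT x₀ x) (z := z₀)
    (fun z ↦ (hT _).trans (apply_sheetLift cov q hz₀ x z))
    (by rw [sheetLift_base]; exact congrArg T (sheetLift_base cov q hz₀ x))) z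

variable {q} in
lemma sheet_transition_comm {z z' : P} {c : p ⁻¹' {x₀} → p ⁻¹' {x₀}}
    (hc : ∀ x, sheetLift cov q hz₀ (c x) z' = sheetLift cov q hz₀ x z) (x : p ⁻¹' {x₀}) :
    c (fiberMap T hT x₀ x) = fiberMap T hT x₀ (c x) := by
  refine sheetLift_injective cov hz₀ (z := z') ?_
  rw [hc, ← apply_sheetLift_deck, ← apply_sheetLift_deck, hc]

variable {q} in
lemma isOpen_of_isOpen_preimage_sheetLift (hq : Topology.IsQuotientMap q) {U : Set Y}
    (hU : ∀ x, IsOpen (sheetLift cov q hz₀ x ⁻¹' U)) : IsOpen U := by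
  refine isOpen_iff_mem_nhds.2 fun y hy ↦ ?_
  obtain ⟨φ, hyφ, hφ⟩ := cov.isLocalHomeomorph y
  have h1 : IsOpen (p '' (U ∩ φ.source)) := by
    rw [← hq.isOpen_preimage]
    refine isOpen_iff_mem_nhds.2 ?_
    rintro z ⟨y', ⟨hy'U, hy'φ⟩, hz⟩
    obtain ⟨x, rfl⟩ := exists_sheetLift_eq cov q hz₀ hz
    refine Filter.mem_of_superset (((hU x).inter
      (φ.open_source.preimage (sheetLift cov q hz₀ x).continuous)).mem_nhds ⟨hy'U, hy'φ⟩) ?_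
    rintro z' ⟨h, h'⟩
    exact ⟨_, ⟨h, h'⟩, apply_sheetLift cov q hz₀ x z'⟩
  refine Filter.mem_of_superset ((φ.open_source.inter (h1.preimage p.continuous)).mem_nhds
    ⟨hyφ, y, ⟨hy, hyφ⟩, rfl⟩) ?_
  rintro y' ⟨hy'φ, y'', ⟨hy'', hy''φ⟩, h⟩
  rw [hφ] at h
  rwa [← φ.injOn hy''φ hy'φ h]

variable {q} in
/-- Compatible functions on the sheets of a covering glue to a map to the circle. -/
lemma exists_map_sheetLift (hq : Topology.IsQuotientMap q) (F : p ⁻¹' {x₀} → C(P, ℝ))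
    (hF : ∀ x x' z z', sheetLift cov q hz₀ x z = sheetLift cov q hz₀ x' z' →
      (F x z : UnitAddCircle) = F x' z') :
    ∃ f : C(Y, UnitAddCircle), ∀ x z, f (sheetLift cov q hz₀ x z) = F x z := by
  have hsurj (y : Y) : ∃ a : (p ⁻¹' {x₀}) × P, sheetLift cov q hz₀ a.1 a.2 = y := by
    obtain ⟨z, hz⟩ := hq.surjective (p y)
    obtain ⟨x, hx⟩ := exists_sheetLift_eq cov q hz₀ hz.symm
    exact ⟨(x, z), hx⟩
  choose s hs using hsurj
  have key (x z) : (F (s (sheetLift cov q hz₀ x z)).1 (s (sheetLift cov q hz₀ x z)).2 :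
      UnitAddCircle) = F x z := hF _ _ _ _ (hs _)
  refine ⟨⟨fun y ↦ F (s y).1 (s y).2, ⟨fun O hO ↦
    isOpen_of_isOpen_preimage_sheetLift cov hz₀ hq fun x ↦ ?_⟩⟩, key⟩
  have : Continuous fun z ↦ (F x z : UnitAddCircle) :=
    UnitAddCircle.isCoveringMap_coe.continuous.comp (F x).continuous
  convert hO.preimage this using 1
  ext z
  simp only [Set.mem_preimage, key]

variable {q} in
lemma exists_int_eq_of_real_lift {F : p ⁻¹' {x₀} → C(P, ℝ)} {f : C(Y, UnitAddCircle)}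
    (hf : ∀ x z, f (sheetLift cov q hz₀ x z) = F x z) {u : C(Y, ℝ)}
    (hu : ∀ y, (u y : UnitAddCircle) = f (T y) - f y) :
    ∃ b : p ⁻¹' {x₀} → ℤ, ∀ x z,
      u (sheetLift cov q hz₀ x z) = F (fiberMap T hT x₀ x) z - F x z + b x := by
  have key (x) : ∃ b : ℤ, ∀ z,
      u (sheetLift cov q hz₀ x z) - (F (fiberMap T hT x₀ x) z - F x z) = b := by
    refine exists_int_sub_eq (g := fun z ↦ u (sheetLift cov q hz₀ x z))
      (g' := fun z ↦ F (fiberMap T hT x₀ x) z - F x z) (by fun_prop) (by fun_prop) fun z ↦ ?_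
    rw [hu, AddCircle.coe_sub, apply_sheetLift_deck (hT := hT), hf, hf]
  choose b hb using key
  exact ⟨b, fun x z ↦ by linarith [hb x z]⟩

end SheetLift

section FiberMap

variable {Y S : Type*} [TopologicalSpace Y] [TopologicalSpace S] {x₀ : S}
  {K : Subgroup (FundamentalGroup S x₀)} {p : C(Y, S)} {e : Y} {he : p e = x₀}

lemma projClass_endpoint_eq (cov : IsCoveringMap p) {a b b' : Y} {ha : p a = x₀} {hb : p b = x₀}
    {hb' : p b' = x₀} {c : Path a b} {c' : Path a b'}
    (h : projClass p ha hb c = projClass p ha hb' c') : b = b' := by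
  have h1 := cov.liftPath_apply_one_eq_of_homotopicRel (projClass_eq_iff.1 h) a
    (by simp) (by simp)
  rw [← (cov.eq_liftPath_iff' (Γ := c.toContinuousMap) (by simp)).2 ⟨rfl, by simp⟩,
    ← (cov.eq_liftPath_iff' (Γ := c'.toContinuousMap) (by simp)).2 ⟨rfl, by simp⟩] at h1
  simpa using h1

lemma IsAssociatedCover.finite_fiber [K.FiniteIndex] (hp : IsAssociatedCover K p e he) :
    Finite (p ⁻¹' {x₀}) := by
  have := hp.connected
  have hx (x : p ⁻¹' {x₀}) : p x.1 = x₀ := x.2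
  let c (x : p ⁻¹' {x₀}) : Path e x.1 := PathConnectedSpace.somePath e x
  refine Finite.of_injective
    (fun x ↦ (projClass p he (hx x) (c x) : FundamentalGroup S x₀ ⧸ K)) fun x y h ↦ ?_
  obtain ⟨α, hα⟩ := hp.exists_projClass_eq (QuotientGroup.eq.1 h)
  refine Subtype.ext (projClass_endpoint_eq hp.covering (c := α.trans (c x)) (c' := c y)
    (ha := he) (hb := hx x) (hb' := hx y) ?_)
  rw [projClass_trans (hb := he), hα, mul_inv_cancel_left]

lemma exists_iterate_eq_id {X : Type*} [Finite X] {T : X → X} (hT : T.Injective) :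
    ∃ d ≠ 0, T^[d] = id := by
  let σ : Equiv.Perm X := Equiv.ofBijective T (Finite.injective_iff_bijective.1 hT)
  refine ⟨orderOf σ, (orderOf_pos σ).ne', ?_⟩
  have h := pow_orderOf_eq_one σ
  have h' : ⇑(σ ^ orderOf σ) = T^[orderOf σ] := Equiv.Perm.coe_pow σ _
  rw [← h', h]
  rfl

lemma IsAssociatedCover.fiberMap_injective [K.Normal] [LocallyPathConnectedSpace Y]
    (hp : IsAssociatedCover K p e he) {T : C(Y, Y)} (hT : ∀ y, p (T y) = p y) :
    (fiberMap T hT x₀).Injective := by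
  have := hp.connected
  obtain ⟨T', hT'e, hT'⟩ := hp.exists_deck (a := T e) (b := e) ((hT e).trans he) he
  have h : T'.comp T = ContinuousMap.id Y :=
    hp.eq_of_apply_eq (a := e) (fun y ↦ by simp [hT, hT']) (by simp [hT'e])
  intro x y hxy
  have h1 : T x = T y := congrArg Subtype.val hxy
  have h2 := congrArg T' h1
  exact Subtype.ext (((DFunLike.congr_fun h x.1).symm.trans h2).trans (DFunLike.congr_fun h y.1))

lemma IsAssociatedCover.fiberMap_ne_id (hp : IsAssociatedCover K p e he) {T : C(Y, Y)}
    (hT : ∀ y, p (T y) = p y) (hT' : T ≠ ContinuousMap.id Y) : fiberMap T hT x₀ ≠ id := by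
  have := hp.connected
  refine fun h ↦ hT' (hp.eq_of_apply_eq (a := e) hT ?_)
  exact congrArg Subtype.val (congrFun h ⟨e, he⟩)

end FiberMap

section SidePoints

variable {N : ℕ}

lemma sidePoint_eq_exp (N k : ℕ) (t : ℝ) :
    sidePoint N k t = Complex.exp (((2 * Real.pi * ((k + t) / N) : ℝ) : ℂ) * Complex.I) := by
  rw [sidePoint]
  congr 1
  push_cast
  ring

lemma norm_sidePoint (N k : ℕ) (t : ℝ) : ‖sidePoint N k t‖ = 1 := by
  rw [sidePoint_eq_exp, Complex.norm_exp_ofReal_mul_I]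

lemma sidePoint_one (N k : ℕ) : sidePoint N k 1 = sidePoint N (k + 1) 0 := by
  simp [sidePoint]

lemma sidePoint_eq_iff (hN : 0 < N) {k l : ℕ} {s t : ℝ} :
    sidePoint N k s = sidePoint N l t ↔ ∃ a : ℤ, k + s = l + t + a * N := by
  have hN' : (N : ℝ) ≠ 0 := by positivity
  have hpi := Real.pi_ne_zero
  rw [sidePoint_eq_exp, sidePoint_eq_exp, Complex.exp_eq_exp_iff_exists_int]
  refine exists_congr fun a ↦ ?_
  have h1 : ((2 * Real.pi * ((k + s) / N) : ℝ) : ℂ) * Complex.I =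
      ((2 * Real.pi * ((l + t) / N) : ℝ) : ℂ) * Complex.I + a * (2 * Real.pi * Complex.I) ↔
      (((2 * Real.pi * ((k + s) / N) : ℝ) : ℂ)) * Complex.I =
        ((2 * Real.pi * ((l + t) / N) + a * (2 * Real.pi) : ℝ) : ℂ) * Complex.I := by
    push_cast
    ring_nf
  rw [h1, mul_left_inj' Complex.I_ne_zero, Complex.ofReal_inj]
  constructor
  · intro h
    field_simp at h
    linarith
  · intro h
    rw [h]
    field_simp

lemma sidePoint_pow (hN : 0 < N) (k : ℕ) (t : ℝ) :
    sidePoint N k t ^ N = sidePoint 1 0 t := by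
  rw [sidePoint_eq_exp, sidePoint_eq_exp, ← Complex.exp_nat_mul, Complex.exp_eq_exp_iff_exists_int]
  refine ⟨k, ?_⟩
  have : (N : ℂ) ≠ 0 := by exact_mod_cast hN.ne'
  push_cast
  field_simp
  ring

lemma sidePoint_zero_zero (N : ℕ) : sidePoint N 0 0 = 1 := by simp [sidePoint]

lemma sidePoint_pow_eq_one_iff (hN : 0 < N) (k : ℕ) {t : ℝ} (ht : t ∈ Set.Icc (0 : ℝ) 1) :
    sidePoint N k t ^ N = 1 ↔ t = 0 ∨ t = 1 := by
  rw [sidePoint_pow hN, ← sidePoint_zero_zero 1, sidePoint_eq_iff one_pos]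
  constructor
  · rintro ⟨a, ha⟩
    have ha' : t = a := by simpa using ha
    have h0 : (0 : ℝ) ≤ a := ha' ▸ ht.1
    have h1 : (a : ℝ) ≤ 1 := ha' ▸ ht.2
    norm_cast at h0 h1
    obtain rfl | rfl : a = 0 ∨ a = 1 := by omega
    · simp [ha']
    · simp [ha']
  · rintro (rfl | rfl)
    · exact ⟨0, by simp⟩
    · exact ⟨1, by simp⟩

lemma exists_eq_sidePoint_of_pow_eq_one (hN : 0 < N) {z : ℂ} (hz : z ^ N = 1) :
    ∃ k : ℕ, z = sidePoint N k 0 := by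
  have : NeZero N := ⟨hN.ne'⟩
  obtain ⟨k, -, rfl⟩ := (Complex.isPrimitiveRoot_exp N hN.ne').eq_pow_of_pow_eq_one hz
  refine ⟨k, ?_⟩
  rw [sidePoint, ← Complex.exp_nat_mul]
  congr 1
  push_cast
  ring

lemma sidePoint_inj (hN : 0 < N) {k l : ℕ} {s t : ℝ} (hk : k < N) (hl : l < N)
    (hs : s ∈ Set.Icc (0 : ℝ) 1) (ht : t ∈ Set.Ioo (0 : ℝ) 1)
    (h : sidePoint N k s = sidePoint N l t) : k = l := by
  obtain ⟨a, ha⟩ := (sidePoint_eq_iff hN).1 h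
  have h1 : ((k : ℤ) : ℝ) < ((l + a * N + 1 : ℤ) : ℝ) := by
    push_cast
    linarith [hs.1, ht.2]
  have h2 : ((l + a * N - 1 : ℤ) : ℝ) < ((k : ℤ) : ℝ) := by
    push_cast
    linarith [hs.2, ht.1]
  rw [Int.cast_lt] at h1 h2
  have h3 : (k : ℤ) = l + a * N := by omega
  have h4 : (k : ℤ) % N = (l : ℤ) % N := by rw [h3, Int.add_mul_emod_self_right]
  have hk' : (k : ℤ) % N = k := Int.emod_eq_of_lt (by positivity) (by exact_mod_cast hk)
  have hl' : (l : ℤ) % N = l := Int.emod_eq_of_lt (by positivity) (by exact_mod_cast hl)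
  rw [hk', hl'] at h4
  exact_mod_cast h4

end SidePoints

section Polygon

variable {g m : ℕ}

lemma SidePair.lt {k l : ℕ} (h : SidePair g m k l) : k < 4 * g + 2 * m ∧ l < 4 * g + 2 * m := by
  cases h <;> omega

lemma Glued.pow_eq_one_iff (hN : 0 < 4 * g + 2 * m) {x y : Metric.closedBall (0 : ℂ) 1}
    (h : Glued g m x y) : (x : ℂ) ^ (4 * g + 2 * m) = 1 ↔ (y : ℂ) ^ (4 * g + 2 * m) = 1 := by
  obtain ⟨k, l, t, -, ht, hx, hy⟩ := h
  rw [hx, hy, sidePoint_pow_eq_one_iff hN _ ht,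
    sidePoint_pow_eq_one_iff hN _ ⟨by linarith [ht.2], by linarith [ht.1]⟩]
  constructor <;> rintro (h | h) <;> [right; left; right; left] <;> linarith

lemma mk_mem_cornerPoints_iff (hN : 0 < 4 * g + 2 * m) (z : Metric.closedBall (0 : ℂ) 1) :
    (Quot.mk _ z : ClosedSurface g m) ∈ cornerPoints g m ↔ (z : ℂ) ^ (4 * g + 2 * m) = 1 := by
  constructor
  · rintro ⟨z', k, hz', h⟩
    have h' := congrArg (Quot.lift (fun z : Metric.closedBall (0 : ℂ) 1 ↦
      (z : ℂ) ^ (4 * g + 2 * m) = 1) fun _ _ h ↦ propext (h.pow_eq_one_iff hN)) h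
    refine h'.mp ?_
    change (z' : ℂ) ^ (4 * g + 2 * m) = 1
    rw [hz', sidePoint_pow_eq_one_iff hN _ (by simp)]
    simp
  · intro h
    obtain ⟨k, hk⟩ := exists_eq_sidePoint_of_pow_eq_one hN h
    exact ⟨z, k, hk, rfl⟩

variable {n : ℕ}

/-- The closed disc, with the corners of the polygon removed if the surface has punctures. -/
def polygonDomain (g n : ℕ) : Set ℂ :=
  {z | z ∈ Metric.closedBall (0 : ℂ) 1 ∧ (0 < n → z ^ (4 * g + 2 * (n - 1)) ≠ 1)}

lemma convex_polygonDomain (hN : 0 < 4 * g + 2 * (n - 1)) : Convex ℝ (polygonDomain g n) := by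
  intro x hx y hy a b ha hb hab
  rcases eq_or_ne x y with rfl | hxy
  · rwa [← add_smul, hab, one_smul]
  rcases ha.eq_or_lt with rfl | ha
  · obtain rfl : b = 1 := by linarith
    simpa using hy
  rcases hb.eq_or_lt with rfl | hb
  · obtain rfl : a = 1 := by linarith
    simpa using hx
  have h := strictConvex_closedBall ℝ (0 : ℂ) 1 hx.1 hy.1 hxy ha hb hab
  refine ⟨interior_subset h, fun _ h1 ↦ ?_⟩
  rw [interior_closedBall _ one_ne_zero, mem_ball_zero_iff] at h
  have := Complex.norm_eq_one_of_pow_eq_one h1 hN.ne'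
  linarith

lemma zero_mem_polygonDomain (hN : 0 < 4 * g + 2 * (n - 1)) : (0 : ℂ) ∈ polygonDomain g n :=
  ⟨by simp, fun _ ↦ by rw [zero_pow hN.ne']; exact zero_ne_one⟩

lemma simplyConnectedSpace_polygonDomain (hN : 0 < 4 * g + 2 * (n - 1)) :
    SimplyConnectedSpace (polygonDomain g n) := by
  have := (convex_polygonDomain hN).contractibleSpace ⟨0, zero_mem_polygonDomain hN⟩
  infer_instance

lemma locallyPathConnectedSpace_polygonDomain (hN : 0 < 4 * g + 2 * (n - 1)) :
    LocallyPathConnectedSpace (polygonDomain g n) :=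
  (convex_polygonDomain hN).locallyPathConnectedSpace

lemma mk_notMem_cornerPoints_iff (hN : 0 < 4 * g + 2 * (n - 1)) (z : Metric.closedBall (0 : ℂ) 1) :
    (0 < n → (Quot.mk _ z : ClosedSurface g (n - 1)) ∉ cornerPoints g (n - 1)) ↔
      (z : ℂ) ∈ polygonDomain g n := by
  simp only [mk_mem_cornerPoints_iff hN]
  exact ⟨fun h ↦ ⟨z.2, h⟩, fun h ↦ h.2⟩

/-- The projection of the polygon to the surface. -/
def polygonMap (hN : 0 < 4 * g + 2 * (n - 1)) : C(polygonDomain g n, StandardSurface g n) where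
  toFun z := ⟨Quot.mk _ ⟨z, z.2.1⟩, (mk_notMem_cornerPoints_iff hN _).2 z.2⟩
  continuous_toFun := (continuous_quot_mk.comp (by fun_prop)).subtype_mk _

lemma isQuotientMap_polygonMap (hN : 0 < 4 * g + 2 * (n - 1)) :
    Topology.IsQuotientMap (polygonMap hN) := by
  let U : Set (ClosedSurface g (n - 1)) := {x | 0 < n → x ∉ cornerPoints g (n - 1)}
  have hU : IsOpen U := by
    rw [← isQuotientMap_quot_mk.isOpen_preimage]
    have : (Quot.mk (Glued g (n - 1))) ⁻¹' U =
        {z : Metric.closedBall (0 : ℂ) 1 | 0 < n → (z : ℂ) ^ (4 * g + 2 * (n - 1)) ≠ 1} := by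
      ext z
      change (0 < n → _) ↔ (0 < n → _)
      simp only [mk_mem_cornerPoints_iff hN, ne_eq]
    rw [this]
    by_cases hn : 0 < n
    · simp only [hn, forall_const]
      exact isOpen_ne_fun (by fun_prop) continuous_const
    · simp [hn]
  let φ : polygonDomain g n ≃ₜ (Quot.mk (Glued g (n - 1))) ⁻¹' U :=
    { toFun := fun z ↦ ⟨⟨z, z.2.1⟩, (mk_notMem_cornerPoints_iff hN _).2 z.2⟩
      invFun := fun z ↦ ⟨z, (mk_notMem_cornerPoints_iff hN _).1 z.2⟩
      left_inv := fun _ ↦ rfl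
      right_inv := fun _ ↦ rfl
      continuous_toFun := by fun_prop
      continuous_invFun := by fun_prop }
  exact (isQuotientMap_quot_mk.restrictPreimage_isOpen hU).comp φ.isQuotientMap

lemma polygonMap_eq_of_glued (hN : 0 < 4 * g + 2 * (n - 1)) {z z' : polygonDomain g n}
    (h : Glued g (n - 1) ⟨z, z.2.1⟩ ⟨z', z'.2.1⟩) : polygonMap hN z = polygonMap hN z' :=
  Subtype.ext (Quot.sound h)

lemma rel_of_polygonMap_eq (hN : 0 < 4 * g + 2 * (n - 1))
    {R : polygonDomain g n → polygonDomain g n → Prop} (hR : Equivalence R)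
    (H : ∀ z z' : polygonDomain g n, Glued g (n - 1) ⟨z, z.2.1⟩ ⟨z', z'.2.1⟩ → R z z')
    {z z' : polygonDomain g n} (h : polygonMap hN z = polygonMap hN z') : R z z' := by
  let R' (b b' : Metric.closedBall (0 : ℂ) 1) : Prop :=
    ((b : ℂ) ∈ polygonDomain g n ↔ (b' : ℂ) ∈ polygonDomain g n) ∧
      ∀ (hb : (b : ℂ) ∈ polygonDomain g n) (hb' : (b' : ℂ) ∈ polygonDomain g n),
        R ⟨b, hb⟩ ⟨b', hb'⟩
  have hR' : Equivalence R' :=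
    ⟨fun b ↦ ⟨Iff.rfl, fun _ _ ↦ hR.refl _⟩,
      fun h ↦ ⟨h.1.symm, fun hb hb' ↦ hR.symm (h.2 hb' hb)⟩,
      fun h h' ↦ ⟨h.1.trans h'.1, fun hb hb' ↦ hR.trans (h.2 hb (h.1.1 hb)) (h'.2 _ hb')⟩⟩
  have hglue (b b') (h : Glued g (n - 1) b b') : R' b b' := by
    refine ⟨?_, fun hb hb' ↦ H _ _ h⟩
    change (_ ∧ _) ↔ (_ ∧ _)
    rw [ne_eq, ne_eq, h.pow_eq_one_iff hN]
    exact and_congr_left fun _ ↦ ⟨fun _ ↦ b'.2, fun _ ↦ b.2⟩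
  have h1 := Quot.eqvGen_exact (congrArg Subtype.val h)
  exact (hR'.eqvGen_iff.1 (h1.mono hglue)).2 z.2 z'.2

end Polygon

section PairIndex

/-- The number of the pair to which a side of the polygon belongs. -/
def pairIndex (g s : ℕ) : ℕ :=
  if s < 4 * g then 2 * (s / 4) + s % 2 else 2 * g + (s - 4 * g) / 2

/-- The first side of a pair of sides of the polygon. -/
def firstSide (g j : ℕ) : ℕ :=
  if j < 2 * g then 4 * (j / 2) + j % 2 else 4 * g + 2 * (j - 2 * g)

variable {g m : ℕ}

lemma pairIndex_lt {s : ℕ} (hs : s < 4 * g + 2 * m) : pairIndex g s < 2 * g + m := by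
  unfold pairIndex
  split_ifs <;> omega

lemma firstSide_lt {j : ℕ} (hj : j < 2 * g + m) : firstSide g j < 4 * g + 2 * m := by
  unfold firstSide
  split_ifs <;> omega

lemma pairIndex_firstSide (g j : ℕ) : pairIndex g (firstSide g j) = j := by
  unfold pairIndex firstSide
  split_ifs <;> omega

lemma SidePair.pairIndex_eq {k l : ℕ} (h : SidePair g m k l) : pairIndex g k = pairIndex g l := by
  unfold pairIndex
  cases h <;> split_ifs <;> omega

lemma SidePair.firstSide_pairIndex {k l : ℕ} (h : SidePair g m k l) :
    firstSide g (pairIndex g k) = k := by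
  unfold pairIndex firstSide
  cases h <;> split_ifs <;> omega

lemma SidePair.ne {k l : ℕ} (h : SidePair g m k l) : k ≠ l := by
  cases h <;> omega

lemma eq_firstSide_or_sidePair {s : ℕ} (hs : s < 4 * g + 2 * m) :
    firstSide g (pairIndex g s) = s ∨ SidePair g m (firstSide g (pairIndex g s)) s := by
  by_cases h : s < 4 * g
  · obtain h4 | h4 : s % 4 < 2 ∨ 2 ≤ s % 4 := by omega
    · left
      unfold pairIndex firstSide
      split_ifs <;> omega
    · right
      obtain h4 | h4 : s % 4 = 2 ∨ s % 4 = 3 := by omega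
      · have := SidePair.handleA (g := g) (m := m) (s / 4) (by omega)
        convert this using 1
        · unfold pairIndex firstSide
          split_ifs <;> omega
        · omega
      · have := SidePair.handleB (g := g) (m := m) (s / 4) (by omega)
        convert this using 1
        · unfold pairIndex firstSide
          split_ifs <;> omega
        · omega
  · obtain h2 | h2 : (s - 4 * g) % 2 = 0 ∨ (s - 4 * g) % 2 = 1 := by omega
    · left
      unfold pairIndex firstSide
      split_ifs <;> omega
    · right
      have := SidePair.fold (g := g) (m := m) ((s - 4 * g) / 2) (by omega)
      convert this using 1
      · unfold pairIndex firstSide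
        split_ifs <;> omega
      · omega

end PairIndex

section BoundaryFunctions

variable {g n : ℕ}

lemma exists_side_function (hN : 0 < 4 * g + 2 * (n - 1)) (hn : 0 < n) (s : ℕ)
    (hs : s < 4 * g + 2 * (n - 1)) :
    ∃ φ : C(polygonDomain g n, ℝ), ∀ k < 4 * g + 2 * (n - 1), ∀ t ∈ Set.Icc (0 : ℝ) 1,
      ∀ z : polygonDomain g n, (z : ℂ) = sidePoint (4 * g + 2 * (n - 1)) k t →
        φ z = if k = s then 1 else 0 := by
  set N := 4 * g + 2 * (n - 1) with hN_def
  have hcont (k : ℕ) : Continuous (sidePoint N k) := by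
    unfold sidePoint
    fun_prop
  have hcl (k : ℕ) : IsClosed (sidePoint N k '' Set.Icc 0 1) :=
    (isCompact_Icc.image (hcont k)).isClosed
  let C₀ : Set (polygonDomain g n) :=
    Subtype.val ⁻¹' ⋃ k ∈ (Finset.range N).erase s, sidePoint N k '' Set.Icc 0 1
  let C₁ : Set (polygonDomain g n) := Subtype.val ⁻¹' (sidePoint N s '' Set.Icc 0 1)
  have hC₀ : IsClosed C₀ := IsClosed.preimage continuous_subtype_val
    (isClosed_biUnion_finset fun k _ ↦ hcl k)
  have hC₁ : IsClosed C₁ := (hcl s).preimage continuous_subtype_val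
  have hdisj : Disjoint C₀ C₁ := by
    rw [Set.disjoint_left]
    intro z hz₀ hz₁
    obtain ⟨t, ht, hzt⟩ := hz₁
    obtain ⟨k, hk, t', ht', hzt'⟩ := Set.mem_iUnion₂.1 hz₀
    rw [Finset.mem_erase, Finset.mem_range] at hk
    have hz := z.2.2 hn
    rw [← hzt, ne_eq, sidePoint_pow_eq_one_iff hN _ ht, not_or] at hz
    exact hk.1 (sidePoint_inj hN hk.2 hs ht' ⟨lt_of_le_of_ne ht.1 (Ne.symm hz.1),
      lt_of_le_of_ne ht.2 hz.2⟩ (hzt'.trans hzt.symm))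
  obtain ⟨φ, h₀, h₁, -⟩ := exists_continuous_zero_one_of_isClosed hC₀ hC₁ hdisj
  refine ⟨φ, fun k hk t ht z hz ↦ ?_⟩
  split_ifs with h
  · subst h
    exact h₁ ⟨t, ht, hz.symm⟩
  · exact h₀ (Set.mem_iUnion₂.2 ⟨k, by simp [h, hk], t, ht, hz.symm⟩)

/-- The piecewise linear function with slope `W r` on `[r, r + 1]`. -/
def piecewiseLinear (N : ℕ) (W : ℕ → ℝ) (x : ℝ) : ℝ :=
  ∑ r ∈ Finset.range N, W r * max 0 (min 1 (x - r))

lemma piecewiseLinear_add {N s : ℕ} (hs : s < N) (W : ℕ → ℝ) {t : ℝ} (ht : t ∈ Set.Icc (0 : ℝ) 1) :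
    piecewiseLinear N W (s + t) = ∑ r ∈ Finset.range s, W r + W s * t := by
  obtain ⟨d, rfl⟩ := Nat.exists_eq_add_of_lt hs
  rw [piecewiseLinear, show s + d + 1 = (s + 1) + d by ring, Finset.sum_range_add,
    Finset.sum_range_succ]
  have h1 : ∑ r ∈ Finset.range s, W r * max 0 (min 1 ((s : ℝ) + t - r)) =
      ∑ r ∈ Finset.range s, W r := by
    refine Finset.sum_congr rfl fun r hr ↦ ?_
    have : ((r + 1 : ℕ) : ℝ) ≤ s := by exact_mod_cast Finset.mem_range.1 hr
    push_cast at this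
    rw [min_eq_left (by linarith [ht.1]), max_eq_right zero_le_one, mul_one]
  have h2 : ∑ r ∈ Finset.range d, W (s + 1 + r) * max 0 (min 1 ((s : ℝ) + t - (s + 1 + r : ℕ))) =
      0 := by
    refine Finset.sum_eq_zero fun r _ ↦ ?_
    have : (0 : ℝ) ≤ r := r.cast_nonneg
    push_cast
    rw [max_eq_left ((min_le_right _ _).trans (by linarith [ht.2])), mul_zero]
  rw [h1, h2, add_sub_cancel_left, min_eq_right ht.2, max_eq_right ht.1, add_zero]

lemma exists_boundary_function (hN : 0 < 4 * g + 2 * (n - 1)) (hn : ¬ 0 < n) (W : ℕ → ℝ)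
    (hW : ∑ r ∈ Finset.range (4 * g + 2 * (n - 1)), W r = 0) :
    ∃ F : C(polygonDomain g n, ℝ), ∀ s < 4 * g + 2 * (n - 1), ∀ t ∈ Set.Icc (0 : ℝ) 1,
      ∀ z : polygonDomain g n, (z : ℂ) = sidePoint (4 * g + 2 * (n - 1)) s t →
        F z = ∑ r ∈ Finset.range s, W r + W s * t := by
  set N := 4 * g + 2 * (n - 1) with hN_def
  have hN' : (0 : ℝ) < N := by exact_mod_cast hN
  have : Fact ((0 : ℝ) < N) := ⟨hN'⟩
  have h0 : piecewiseLinear N W 0 = 0 := by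
    simpa using piecewiseLinear_add hN W (t := 0) (by simp)
  have h1 : piecewiseLinear N W N = 0 := by
    obtain ⟨N', hN''⟩ := Nat.exists_eq_succ_of_ne_zero hN.ne'
    have := piecewiseLinear_add (N := N) (s := N') (by omega) W (t := 1) (by simp)
    rw [mul_one, ← Finset.sum_range_succ, ← Nat.succ_eq_add_one, ← hN'', hW] at this
    rw [← this, hN'']
    push_cast
    rfl
  have hcont : Continuous (piecewiseLinear N W) := by
    unfold piecewiseLinear
    fun_prop
  let f₀ : C(AddCircle (N : ℝ), ℝ) := ⟨AddCircle.liftIco (N : ℝ) 0 (piecewiseLinear N W),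
    AddCircle.liftIco_continuous (by rw [zero_add, h0, h1]) hcont.continuousOn⟩
  have hf₀ {s : ℕ} {t : ℝ} (hs : s < N) (ht : t ∈ Set.Icc (0 : ℝ) 1) :
      f₀ ((s + t : ℝ) : AddCircle (N : ℝ)) = piecewiseLinear N W (s + t) := by
    have hs' : ((s + 1 : ℕ) : ℝ) ≤ N := by exact_mod_cast hs
    push_cast at hs'
    rcases (show (s : ℝ) + t ≤ N by linarith [ht.2]).lt_or_eq with h | h
    · have hst : (0 : ℝ) ≤ s + t := add_nonneg s.cast_nonneg ht.1
      exact AddCircle.liftIco_coe_apply (f := piecewiseLinear N W) ⟨hst, by rwa [zero_add]⟩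
    · rw [h, h1, AddCircle.coe_period, ← AddCircle.coe_zero]
      exact (AddCircle.liftIco_coe_apply ⟨le_rfl, by linarith⟩).trans h0
  let E := AddCircle.homeomorphCircle hN'.ne'
  let ι : Circle → polygonDomain g n := fun z ↦ ⟨z, by simp [Circle.norm_coe], fun h ↦ (hn h).elim⟩
  have hι : Topology.IsClosedEmbedding ι :=
    Continuous.isClosedEmbedding (by fun_prop) fun a b h ↦ Circle.ext (congrArg (fun w : polygonDomain g n ↦ (w : ℂ)) h)
  obtain ⟨F, hF⟩ := ContinuousMap.exists_extension hι (f₀.comp (E.symm : C(Circle, AddCircle (N : ℝ))))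
  refine ⟨F, fun s hs t ht z hz ↦ ?_⟩
  have hz' : z = ι (E ((s + t : ℝ) : AddCircle (N : ℝ))) := by
    refine Subtype.ext (hz.trans ?_)
    change _ = ((E ((s + t : ℝ) : AddCircle (N : ℝ)) : Circle) : ℂ)
    rw [AddCircle.homeomorphCircle_apply, AddCircle.toCircle_apply_mk, Circle.coe_exp,
      sidePoint_eq_exp]
    congr 3
    ring
  have hF' := DFunLike.congr_fun hF (E ((s + t : ℝ) : AddCircle (N : ℝ)))
  rw [hz', ← piecewiseLinear_add hs W ht, ← hf₀ hs ht]
  refine hF'.trans ?_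
  exact congrArg f₀ (E.symm_apply_apply _)

end BoundaryFunctions

section SurfaceMap

variable {g n : ℕ} {S : Type*} [TopologicalSpace S]

/-- The projection of the polygon to a space homeomorphic to the standard surface. -/
def surfaceMap (hN : 0 < 4 * g + 2 * (n - 1)) (φ : S ≃ₜ StandardSurface g n) :
    C(polygonDomain g n, S) :=
  (φ.symm : C(StandardSurface g n, S)).comp (polygonMap hN)

variable (hN : 0 < 4 * g + 2 * (n - 1)) (φ : S ≃ₜ StandardSurface g n)

lemma isQuotientMap_surfaceMap : Topology.IsQuotientMap (surfaceMap hN φ) :=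
  φ.symm.isQuotientMap.comp (isQuotientMap_polygonMap hN)

lemma surfaceMap_eq_iff {z z' : polygonDomain g n} :
    surfaceMap hN φ z = surfaceMap hN φ z' ↔ polygonMap hN z = polygonMap hN z' :=
  φ.symm.injective.eq_iff

lemma surfaceMap_eq_of_sidePair {k l : ℕ} (h : SidePair g (n - 1) k l) {t : ℝ}
    (ht : t ∈ Set.Icc (0 : ℝ) 1) {z z' : polygonDomain g n}
    (hz : (z : ℂ) = sidePoint (4 * g + 2 * (n - 1)) k t)
    (hz' : (z' : ℂ) = sidePoint (4 * g + 2 * (n - 1)) l (1 - t)) :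
    surfaceMap hN φ z = surfaceMap hN φ z' :=
  (surfaceMap_eq_iff hN φ).2 (polygonMap_eq_of_glued hN ⟨k, l, t, h, ht, hz, hz'⟩)

/-- The midpoint of a side of the polygon. -/
def sideMid (hN : 0 < 4 * g + 2 * (n - 1)) (s : ℕ) : polygonDomain g n :=
  ⟨sidePoint (4 * g + 2 * (n - 1)) s (1 / 2), by simp [norm_sidePoint], fun _ ↦ by
    rw [ne_eq, sidePoint_pow_eq_one_iff hN s (by norm_num)]
    norm_num⟩

lemma surfaceMap_sideMid {s : ℕ} (hs : s < 4 * g + 2 * (n - 1)) :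
    surfaceMap hN φ (sideMid hN s) = surfaceMap hN φ (sideMid hN (firstSide g (pairIndex g s))) := by
  rcases eq_firstSide_or_sidePair hs with h | h
  · rw [h]
  · exact (surfaceMap_eq_of_sidePair hN φ h (t := 1 / 2) (by norm_num) rfl
      (by rw [sideMid]; norm_num)).symm

/-- A point on a side of the polygon of a closed surface. -/
def sidePt (hn : ¬ 0 < n) (s : ℕ) (t : ℝ) : polygonDomain g n :=
  ⟨sidePoint (4 * g + 2 * (n - 1)) s t, by simp [norm_sidePoint], fun h ↦ (hn h).elim⟩

lemma continuous_sidePt (hn : ¬ 0 < n) (s : ℕ) :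
    Continuous fun t ↦ (sidePt hn s t : polygonDomain g n) := by
  refine Continuous.subtype_mk ?_ _
  unfold sidePoint
  fun_prop

lemma sidePt_one (hn : ¬ 0 < n) (s : ℕ) :
    (sidePt hn s 1 : polygonDomain g n) = sidePt hn (s + 1) 0 :=
  Subtype.ext (sidePoint_one _ s)

lemma surfaceMap_corner_aux (hn : ¬ 0 < n) {k l : ℕ} (h : SidePair g (n - 1) k l) :
    surfaceMap hN φ (sidePt hn k 0) = surfaceMap hN φ (sidePt hn (l + 1) 0) ∧
      surfaceMap hN φ (sidePt hn (k + 1) 0) = surfaceMap hN φ (sidePt hn l 0) := by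
  rw [← sidePt_one hn k, ← sidePt_one hn l]
  exact ⟨surfaceMap_eq_of_sidePair hN φ h (t := 0) (by simp) rfl (by simp [sidePt]),
    surfaceMap_eq_of_sidePair hN φ h (t := 1) (by simp) rfl (by simp [sidePt])⟩

/-- All the corners of the polygon of a closed surface are glued together. -/
lemma surfaceMap_corner (hn : ¬ 0 < n) {s : ℕ} (hs : s ≤ 4 * g + 2 * (n - 1)) :
    surfaceMap hN φ (sidePt hn s 0) = surfaceMap hN φ (sidePt hn 0 0) := by
  let C (k : ℕ) : S := surfaceMap hN φ (sidePt hn k 0)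
  have hA (i : ℕ) (hi : i < g) : C (4 * i) = C (4 * i + 3) ∧ C (4 * i + 1) = C (4 * i + 2) :=
    surfaceMap_corner_aux hN φ hn (.handleA i hi)
  have hB (i : ℕ) (hi : i < g) : C (4 * i + 1) = C (4 * i + 4) ∧ C (4 * i + 2) = C (4 * i + 3) :=
    surfaceMap_corner_aux hN φ hn (.handleB i hi)
  have h4 (i : ℕ) (hi : i ≤ g) : C (4 * i) = C 0 := by
    induction i with
    | zero => rfl
    | succ i ih =>
      rw [← ih (by omega), (hA i hi).1, ← (hB i hi).2, ← (hA i hi).2, (hB i hi).1]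
      rfl
  change C s = C 0
  obtain ⟨i, r, hr, rfl⟩ : ∃ i r, r < 4 ∧ s = 4 * i + r := ⟨s / 4, s % 4, by omega, by omega⟩
  rw [← h4 i (by omega)]
  obtain rfl | hi : r = 0 ∨ i < g := by omega
  · rfl
  · obtain rfl | rfl | rfl | rfl : r = 0 ∨ r = 1 ∨ r = 2 ∨ r = 3 := by omega
    · rfl
    · rw [(hA i hi).1, ← (hB i hi).2, ← (hA i hi).2]
    · rw [(hA i hi).1, ← (hB i hi).2]
    · rw [(hA i hi).1]

end SurfaceMap

section Sheets

variable {g n : ℕ} {S Y : Type*} [TopologicalSpace S] [TopologicalSpace Y]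
  [SimplyConnectedSpace (polygonDomain g n)] [LocallyPathConnectedSpace (polygonDomain g n)]
  {p : C(Y, S)} (cov : IsCoveringMap p) (hN : 0 < 4 * g + 2 * (n - 1))
  (φ : S ≃ₜ StandardSurface g n) {z₀ : polygonDomain g n} {x₀ : S} (hz₀ : surfaceMap hN φ z₀ = x₀)

/-- Functions on the sheets over the polygon glue to a map to the circle if they are compatible
with the gluing of the sides. -/
lemma exists_map_of_glued (F : p ⁻¹' {x₀} → C(polygonDomain g n, ℝ))
    (hF : ∀ z z' : polygonDomain g n, Glued g (n - 1) ⟨z, z.2.1⟩ ⟨z', z'.2.1⟩ → ∀ x x',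
      sheetLift cov (surfaceMap hN φ) hz₀ x z = sheetLift cov (surfaceMap hN φ) hz₀ x' z' →
        (F x z : UnitAddCircle) = F x' z') :
    ∃ f : C(Y, UnitAddCircle), ∀ x z, f (sheetLift cov (surfaceMap hN φ) hz₀ x z) = F x z := by
  refine exists_map_sheetLift cov hz₀ (isQuotientMap_surfaceMap hN φ) F ?_
  let R (z z' : polygonDomain g n) : Prop := surfaceMap hN φ z = surfaceMap hN φ z' ∧ ∀ x x',
      sheetLift cov (surfaceMap hN φ) hz₀ x z = sheetLift cov (surfaceMap hN φ) hz₀ x' z' →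
        (F x z : UnitAddCircle) = F x' z'
  have hR : Equivalence R := by
    refine ⟨fun z ↦ ⟨rfl, fun x x' h ↦ by rw [sheetLift_injective cov hz₀ h]⟩,
      fun h ↦ ⟨h.1.symm, fun x x' h' ↦ (h.2 x' x h'.symm).symm⟩,
      fun {z z' z''} h h' ↦ ⟨h.1.trans h'.1, fun x x'' hx ↦ ?_⟩⟩
    obtain ⟨x', hx'⟩ := exists_sheetLift_eq cov (surfaceMap hN φ) hz₀
      ((apply_sheetLift cov (surfaceMap hN φ) hz₀ x z).trans h.1)
    exact (h.2 x x' hx'.symm).trans (h'.2 x' x'' (hx'.trans hx))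
  intro x x' z z' h
  have hz : surfaceMap hN φ z = surfaceMap hN φ z' := by
    rw [← apply_sheetLift cov (surfaceMap hN φ) hz₀ x, h, apply_sheetLift]
  exact (rel_of_polygonMap_eq hN hR (fun z z' h ↦ ⟨(surfaceMap_eq_iff hN φ).2
    (polygonMap_eq_of_glued hN h), hF z z' h⟩) ((surfaceMap_eq_iff hN φ).1 hz)).2 x x' h

/-- The transitions between the sheets across the sides of the polygon. -/
lemma exists_side_transition : ∃ c : ℕ → p ⁻¹' {x₀} → p ⁻¹' {x₀},
    ∀ s < 4 * g + 2 * (n - 1), ∀ x,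
      sheetLift cov (surfaceMap hN φ) hz₀ (c s x) (sideMid hN (firstSide g (pairIndex g s))) =
        sheetLift cov (surfaceMap hN φ) hz₀ x (sideMid hN s) := by
  have key (s : ℕ) : ∃ c : p ⁻¹' {x₀} → p ⁻¹' {x₀}, s < 4 * g + 2 * (n - 1) → ∀ x,
      sheetLift cov (surfaceMap hN φ) hz₀ (c x) (sideMid hN (firstSide g (pairIndex g s))) =
        sheetLift cov (surfaceMap hN φ) hz₀ x (sideMid hN s) := by
    by_cases hs : s < 4 * g + 2 * (n - 1)
    · obtain ⟨c, hc⟩ := exists_sheet_transition cov (surfaceMap hN φ) hz₀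
        (surfaceMap_sideMid hN φ hs)
      exact ⟨c, fun _ ↦ hc⟩
    · exact ⟨id, fun h ↦ (hs h).elim⟩
  choose c hc using key
  exact ⟨c, hc⟩

end Sheets

section MapsNotLifting

variable {g n : ℕ} {S Y : Type*} [TopologicalSpace S] [TopologicalSpace Y]
  [SimplyConnectedSpace (polygonDomain g n)] [LocallyPathConnectedSpace (polygonDomain g n)]
  {p : C(Y, S)} {z₀ : polygonDomain g n} {x₀ : S} [Finite (p ⁻¹' {x₀})] {T : C(Y, Y)}

lemma exists_map_not_lift_of_punctured (cov : IsCoveringMap p) (hN : 0 < 4 * g + 2 * (n - 1))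
    (φ : S ≃ₜ StandardSurface g n) (hz₀ : surfaceMap hN φ z₀ = x₀) (hT : ∀ y, p (T y) = p y)
    (hn : 0 < n) (hM : 2 ≤ 2 * g + (n - 1))
    (hTinj : (fiberMap T hT x₀).Injective) (hTid : fiberMap T hT x₀ ≠ id) :
    ∃ f : C(Y, UnitAddCircle), ¬ ∃ u : C(Y, ℝ), ∀ y, (u y : UnitAddCircle) = f (T y) - f y := by
  obtain ⟨d, hd, hTd⟩ := exists_iterate_eq_id hTinj
  obtain ⟨c, hc⟩ := exists_side_transition cov hN φ hz₀
  set N := 4 * g + 2 * (n - 1) with hN_def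
  have hpair (s : Fin N) : pairIndex g s < 2 * g + (n - 1) := pairIndex_lt s.2
  have hfirst (j : Fin (2 * g + (n - 1))) : firstSide g j < N := firstSide_lt j.2
  have hcT (s : Fin N) (x) : c s (fiberMap T hT x₀ x) = fiberMap T hT x₀ (c s x) :=
    sheet_transition_comm cov hz₀ hT (hc s s.2) x
  let B : (Option (Fin (2 * g + (n - 1))) → p ⁻¹' {x₀} → ℚ) →ₗ[ℚ] (Fin N → p ⁻¹' {x₀} → ℚ) :=
    { toFun := fun u s x ↦ u (some ⟨_, hpair s⟩) (c s x) - u none x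
      map_add' := fun u v ↦ by
        funext s x
        simp only [Pi.add_apply]
        ring
      map_smul' := fun r u ↦ by
        funext s x
        simp only [Pi.smul_apply, smul_eq_mul, RingHom.id_apply]
        ring }
  obtain ⟨a, -, ha⟩ := exists_int_cochain hd hTd hTid
    (0 : (Fin N → p ⁻¹' {x₀} → ℚ) →ₗ[ℚ] (Fin 0 → p ⁻¹' {x₀} → ℚ)) B (fun _ ↦ rfl)
    (fun w ↦ by
      funext s x
      change w _ (fiberMap T hT x₀ (c s x)) - _ = w _ (c s (fiberMap T hT x₀ x)) - _
      rw [hcT])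
    (by simp only [Fintype.card_fin, Fintype.card_option]; omega)
  choose θ hθ using fun s : Fin N ↦ exists_side_function hN hn s s.2
  let F (x : p ⁻¹' {x₀}) : C(polygonDomain g n, ℝ) := ∑ s, (a s x : ℝ) • θ s
  have hF (x) (k : Fin N) {t : ℝ} (ht : t ∈ Set.Icc (0 : ℝ) 1) (z : polygonDomain g n)
      (hz : (z : ℂ) = sidePoint N k t) : F x z = a k x := by
    simp only [F, ContinuousMap.sum_apply, ContinuousMap.smul_apply, smul_eq_mul]
    rw [Finset.sum_eq_single k]
    · rw [hθ k k k.2 t ht z hz, if_pos rfl, mul_one]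
    · intro s _ hs
      rw [hθ s k k.2 t ht z hz, if_neg (fun h ↦ hs (Fin.ext h.symm)), mul_zero]
    · simp
  obtain ⟨f, hf⟩ := exists_map_of_glued cov hN φ hz₀ F fun z z' ⟨k, l, t, hkl, ht, hz, hz'⟩ x x' _ ↦ by
    rw [hF x ⟨k, hkl.lt.1⟩ ht z hz,
      hF x' ⟨l, hkl.lt.2⟩ (t := 1 - t) ⟨by linarith [ht.2], by linarith [ht.1]⟩ z' hz']
    exact UnitAddCircle.coe_eq_coe_iff.2 ⟨a ⟨k, hkl.lt.1⟩ x - a ⟨l, hkl.lt.2⟩ x', by push_cast; ring⟩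
  refine ⟨f, fun ⟨u, hu⟩ ↦ ?_⟩
  obtain ⟨b, hb⟩ := exists_int_eq_of_real_lift cov hz₀ hT hf hu
  have hmid (k : Fin N) (x) : u (sheetLift cov (surfaceMap hN φ) hz₀ x (sideMid hN k)) =
      ((a k (fiberMap T hT x₀ x) - a k x + b x : ℤ) : ℝ) := by
    rw [hb, hF _ k (t := 1 / 2) (by norm_num) _ rfl, hF _ k (t := 1 / 2) (by norm_num) _ rfl]
    push_cast
    ring
  refine ha (fun j x ↦ j.elim (b x : ℚ) fun j ↦
    ((a ⟨_, hfirst j⟩ (fiberMap T hT x₀ x) - a ⟨_, hfirst j⟩ x + b x : ℤ) : ℚ)) ?_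
  funext s x
  have h1 := hmid s x
  rw [← hc s s.2, hmid ⟨_, hfirst ⟨_, hpair s⟩⟩, Int.cast_inj] at h1
  change ((_ : ℤ) : ℚ) - (b x : ℚ) = _
  simp only [h1]
  push_cast
  ring

lemma exists_map_not_lift_of_closed (cov : IsCoveringMap p) (hN : 0 < 4 * g + 2 * (n - 1))
    (φ : S ≃ₜ StandardSurface g n) (hz₀ : surfaceMap hN φ z₀ = x₀) (hT : ∀ y, p (T y) = p y)
    (hn : ¬ 0 < n) (hM : 2 < 2 * g + (n - 1))
    (hTinj : (fiberMap T hT x₀).Injective) (hTid : fiberMap T hT x₀ ≠ id) :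
    ∃ f : C(Y, UnitAddCircle), ¬ ∃ u : C(Y, ℝ), ∀ y, (u y : UnitAddCircle) = f (T y) - f y := by
  obtain ⟨d, hd, hTd⟩ := exists_iterate_eq_id hTinj
  obtain ⟨c, hc⟩ := exists_side_transition cov hN φ hz₀
  set N := 4 * g + 2 * (n - 1) with hN_def
  set M := 2 * g + (n - 1) with hM_def
  have hfirst (j : Fin M) : firstSide g j < N := firstSide_lt j.2
  have hcT {s : ℕ} (hs : s < N) (x) : c s (fiberMap T hT x₀ x) = fiberMap T hT x₀ (c s x) :=
    sheet_transition_comm cov hz₀ hT (hc s hs) x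
  have hcfirst {s : ℕ} (hs : s < N) (h : firstSide g (pairIndex g s) = s) (x) : c s x = x := by
    have := hc s hs x
    rw [h] at this
    exact sheetLift_injective cov hz₀ this
  have hcorner (s : ℕ) (hs : s ≤ N) : ∃ v : p ⁻¹' {x₀} → p ⁻¹' {x₀}, ∀ x,
      sheetLift cov (surfaceMap hN φ) hz₀ (v x) (sidePt hn 0 0) =
        sheetLift cov (surfaceMap hN φ) hz₀ x (sidePt hn s 0) :=
    exists_sheet_transition cov (surfaceMap hN φ) hz₀ (surfaceMap_corner hN φ hn hs)
  choose v hv using fun j : Fin M ↦ hcorner (firstSide g j) (hfirst j).le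
  choose v' hv' using fun j : Fin M ↦ hcorner (firstSide g j + 1) (hfirst j)
  have hvT (j x) : v j (fiberMap T hT x₀ x) = fiberMap T hT x₀ (v j x) :=
    sheet_transition_comm cov hz₀ hT (hv j) x
  have hvT' (j x) : v' j (fiberMap T hT x₀ x) = fiberMap T hT x₀ (v' j x) :=
    sheet_transition_comm cov hz₀ hT (hv' j) x
  let J (s : ℕ) : Fin M := ⟨pairIndex g s % M, Nat.mod_lt _ (by omega)⟩
  have hJ {s : ℕ} (hs : s < N) : (J s : ℕ) = pairIndex g s := Nat.mod_eq_of_lt (pairIndex_lt hs)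
  let sgn (s : ℕ) : ℤ := if firstSide g (pairIndex g s) = s then 1 else -1
  let A : (Fin M → p ⁻¹' {x₀} → ℚ) →ₗ[ℚ] (Unit → p ⁻¹' {x₀} → ℚ) :=
    { toFun := fun w _ x ↦ ∑ s ∈ Finset.range N, (sgn s : ℚ) * w (J s) (c s x)
      map_add' := fun w w' ↦ by
        funext _ x
        simp only [Pi.add_apply, mul_add, Finset.sum_add_distrib]
      map_smul' := fun r w ↦ by
        funext _ x
        simp only [Pi.smul_apply, smul_eq_mul, RingHom.id_apply, Finset.mul_sum]
        exact Finset.sum_congr rfl fun s _ ↦ by ring }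
  let B : (Unit → p ⁻¹' {x₀} → ℚ) →ₗ[ℚ] (Fin M → p ⁻¹' {x₀} → ℚ) :=
    { toFun := fun u j x ↦ u () (v' j x) - u () (v j x)
      map_add' := fun u u' ↦ by
        funext j x
        simp only [Pi.add_apply]
        ring
      map_smul' := fun r u ↦ by
        funext j x
        simp only [Pi.smul_apply, smul_eq_mul, RingHom.id_apply]
        ring }
  obtain ⟨w, hw, hwB⟩ := exists_int_cochain hd hTd hTid A B
    (fun w ↦ by
      funext _ x
      change ∑ s ∈ Finset.range N, (sgn s : ℚ) * w (J s) (fiberMap T hT x₀ (c s x)) =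
        ∑ s ∈ Finset.range N, (sgn s : ℚ) * w (J s) (c s (fiberMap T hT x₀ x))
      refine Finset.sum_congr rfl fun s hs ↦ ?_
      rw [hcT (Finset.mem_range.1 hs)])
    (fun u ↦ by
      funext j x
      change u _ (fiberMap T hT x₀ (v' j x)) - u _ (fiberMap T hT x₀ (v j x)) =
        u _ (v' j (fiberMap T hT x₀ x)) - u _ (v j (fiberMap T hT x₀ x))
      rw [hvT, hvT'])
    (by simp only [Fintype.card_fin, Fintype.card_unit]; omega)
  let W (x : p ⁻¹' {x₀}) (s : ℕ) : ℤ := sgn s * w (J s) (c s x)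
  have hW (x) : ∑ r ∈ Finset.range N, (W x r : ℝ) = 0 := by
    have h := congrFun (congrFun hw ()) x
    change ∑ s ∈ Finset.range N, (sgn s : ℚ) * (w (J s) (c s x) : ℚ) = 0 at h
    have h' : ∑ s ∈ Finset.range N, W x s = 0 := by exact_mod_cast h
    exact_mod_cast h'
  choose F hF using fun x ↦ exists_boundary_function hN hn (fun s ↦ (W x s : ℝ)) (hW x)
  obtain ⟨f, hf⟩ := exists_map_of_glued cov hN φ hz₀ F fun z z' ⟨k, l, t, hkl, ht, hz, hz'⟩ x x' h ↦ by
    have ht' : 1 - t ∈ Set.Icc (0 : ℝ) 1 := ⟨by linarith [ht.2], by linarith [ht.1]⟩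
    have hmid : sheetLift cov (surfaceMap hN φ) hz₀ x (sideMid hN k) =
        sheetLift cov (surfaceMap hN φ) hz₀ x' (sideMid hN l) := by
      have hc₁ : Continuous fun r : unitInterval ↦
          sheetLift cov (surfaceMap hN φ) hz₀ x (sidePt hn k r) :=
        (ContinuousMap.continuous _).comp ((continuous_sidePt hn k).comp continuous_subtype_val)
      have hc₂ : Continuous fun r : unitInterval ↦
          sheetLift cov (surfaceMap hN φ) hz₀ x' (sidePt hn l (1 - r)) :=
        (ContinuousMap.continuous _).comp ((continuous_sidePt hn l).comp (by fun_prop))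
      have hz₁ : z = sidePt hn k t := Subtype.ext hz
      have hz₂ : z' = sidePt hn l (1 - t) := Subtype.ext hz'
      have heq := cov.eq_of_comp_eq hc₁ hc₂ (by
        funext r
        simp only [Function.comp_apply, apply_sheetLift]
        exact surfaceMap_eq_of_sidePair hN φ hkl r.2 rfl rfl) ⟨t, ht⟩ (by
        dsimp only
        rw [← hz₁, ← hz₂, h])
      have h2 := congrFun heq ⟨1 / 2, by norm_num, by norm_num⟩
      have e1 : (sidePt hn k (1 / 2) : polygonDomain g n) = sideMid hN k := rfl
      have e2 : (sidePt hn l (1 - 1 / 2) : polygonDomain g n) = sideMid hN l :=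
        Subtype.ext (by simp only [sidePt, sideMid]; norm_num)
      dsimp only at h2
      rwa [e1, e2] at h2
    have hxk : c k x = x := hcfirst hkl.lt.1 hkl.firstSide_pairIndex x
    have hxl : c l x' = x := by
      refine sheetLift_injective cov hz₀ (z := sideMid hN k) ?_
      rw [hmid, ← hc l hkl.lt.2 x', ← hkl.pairIndex_eq, hkl.firstSide_pairIndex]
    have hJkl : J k = J l := Fin.ext (by rw [hJ hkl.lt.1, hJ hkl.lt.2, hkl.pairIndex_eq])
    have hWk : W x k = w (J k) x := by
      simp only [W, sgn, hkl.firstSide_pairIndex, if_true, hxk, one_mul]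
    have hWl : W x' l = - w (J k) x := by
      simp only [W, sgn, ← hkl.pairIndex_eq, hkl.firstSide_pairIndex, hkl.ne, if_false, hxl, hJkl,
        neg_mul, one_mul]
    rw [hF x k hkl.lt.1 t ht z hz, hF x' l hkl.lt.2 _ ht' z' hz', hWk, hWl]
    exact UnitAddCircle.coe_eq_coe_iff.2 ⟨∑ r ∈ Finset.range k, W x r -
      ∑ r ∈ Finset.range l, W x' r + w (J k) x, by push_cast; ring⟩
  refine ⟨f, fun ⟨u, hu⟩ ↦ ?_⟩
  obtain ⟨b, hb⟩ := exists_int_eq_of_real_lift cov hz₀ hT hf hu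
  have hu₀ (x) : u (sheetLift cov (surfaceMap hN φ) hz₀ x (sidePt hn 0 0)) = b x := by
    rw [hb, hF _ 0 hN 0 (by simp) _ rfl, hF _ 0 hN 0 (by simp) _ rfl]
    simp
  refine hwB (fun _ x ↦ (b x : ℚ)) ?_
  funext j x
  have h0 := hb x (sidePt hn (firstSide g j) 0)
  have h1 := hb x (sidePt hn (firstSide g j) 1)
  rw [hF _ _ (hfirst j) 0 (by simp) _ rfl, hF _ _ (hfirst j) 0 (by simp) _ rfl, ← hv, hu₀] at h0
  rw [hF _ _ (hfirst j) 1 (by simp) _ rfl, hF _ _ (hfirst j) 1 (by simp) _ rfl, sidePt_one, ← hv',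
    hu₀] at h1
  have hWj (y) : W y (firstSide g j) = w j y := by
    have h := pairIndex_firstSide g j
    have hJj : J (firstSide g j) = j := Fin.ext (by rw [hJ (hfirst j), h])
    simp only [W, sgn, h, if_true, hJj, hcfirst (hfirst j) (by rw [h]), one_mul]
  rw [hWj, hWj] at h0 h1
  have h2 : (b (v' j x) - b (v j x) : ℤ) = w j (fiberMap T hT x₀ x) - w j x := by
    have : ((b (v' j x) - b (v j x) : ℤ) : ℝ) = ((w j (fiberMap T hT x₀ x) - w j x : ℤ) : ℝ) := by
      push_cast
      linarith
    exact_mod_cast this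
  change (b (v' j x) : ℚ) - b (v j x) = _
  exact_mod_cast h2

end MapsNotLifting

section Main

variable {S Y : Type*} [TopologicalSpace S] [TopologicalSpace Y]

lemma IsCoveringMap.locallyPathConnectedSpace [LocallyPathConnectedSpace S] {p : Y → S}
    (cov : IsCoveringMap p) : LocallyPathConnectedSpace Y := by
  refine ⟨fun y ↦ Filter.hasBasis_self.2 fun t ht ↦ ?_⟩
  obtain ⟨φ, hyφ, -⟩ := cov.isLocalHomeomorph y
  have := φ.open_target.locallyPathConnectedSpace
  have := (φ.toHomeomorphSourceTarget.isOpenEmbedding).locallyPathConnectedSpace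
  obtain ⟨V, ⟨hV, hVc⟩, hVt⟩ := (path_connected_basis (⟨y, hyφ⟩ : φ.source)).mem_iff.1
    (continuous_subtype_val.continuousAt.preimage_mem_nhds ht)
  refine ⟨Subtype.val '' V, ?_, hVc.image continuous_subtype_val, Set.image_subset_iff.2 hVt⟩
  exact (φ.open_source.isOpenEmbedding_subtypeVal.image_mem_nhds (x := ⟨y, hyφ⟩)).2 hV

variable {g n : ℕ} {x₀ : S} {K : Subgroup (FundamentalGroup S x₀)} {p : C(Y, S)} {e : Y}
  {he : p e = x₀}

lemma IsHyperbolicSurface.sides_pos (hS : IsHyperbolicSurface g n S) :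
    0 < 4 * g + 2 * (n - 1) := by
  have := hS.hyperbolic
  omega

lemma IsHyperbolicSurface.locallyPathConnectedSpace (hS : IsHyperbolicSurface g n S) :
    LocallyPathConnectedSpace S := by
  obtain ⟨φ⟩ := hS.homeo
  have := locallyPathConnectedSpace_polygonDomain hS.sides_pos
  exact (isQuotientMap_surfaceMap hS.sides_pos φ).locallyPathConnectedSpace

/-- A nontrivial deck transformation of a finite regular covering of a hyperbolic surface acts
nontrivially on the homotopy classes of maps to the circle. -/
lemma IsHyperbolicSurface.exists_map_not_lift (hS : IsHyperbolicSurface g n S) [K.Normal]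
    [K.FiniteIndex] (hp : IsAssociatedCover K p e he) {T : C(Y, Y)} (hT : ∀ y, p (T y) = p y)
    (hT' : T ≠ ContinuousMap.id Y) :
    ∃ f : C(Y, UnitAddCircle), ¬ ∃ u : C(Y, ℝ), ∀ y, (u y : UnitAddCircle) = f (T y) - f y := by
  have hN := hS.sides_pos
  have hhyp := hS.hyperbolic
  obtain ⟨φ⟩ := hS.homeo
  have := hS.locallyPathConnectedSpace
  have := hp.covering.locallyPathConnectedSpace
  have := simplyConnectedSpace_polygonDomain hN
  have := locallyPathConnectedSpace_polygonDomain hN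
  have := hp.finite_fiber
  obtain ⟨z₀, hz₀⟩ := (isQuotientMap_surfaceMap hN φ).surjective x₀
  by_cases hn : 0 < n
  · exact exists_map_not_lift_of_punctured hp.covering hN φ hz₀ hT hn (by omega)
      (hp.fiberMap_injective hT) (hp.fiberMap_ne_id hT hT')
  · exact exists_map_not_lift_of_closed hp.covering hN φ hz₀ hT hn (by omega)
      (hp.fiberMap_injective hT) (hp.fiberMap_ne_id hT hT')

/-- An automorphism that is nontrivial on the deck group acts nontrivially on winding numbers. -/
lemma IsHyperbolicSurface.exists_winding_ne (hS : IsHyperbolicSurface g n S) [K.Characteristic]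
    [K.FiniteIndex] (hp : IsAssociatedCover K p e he)
    {ψ : FundamentalGroup S x₀ ≃* FundamentalGroup S x₀} (hψ : inducedAut K ψ ≠ MulEquiv.refl _) :
    ∃ (α β : Path e e) (f : C(Y, UnitAddCircle)),
      projClass p he he β = ψ (projClass p he he α) ∧ winding f α ≠ winding f β := by
  by_contra! h
  have := hS.locallyPathConnectedSpace
  have := hp.covering.locallyPathConnectedSpace
  obtain ⟨T, hT, hT', H⟩ := hp.exists_deck_of_winding_eq hψ fun α β hβ f ↦ h α β f hβ
  obtain ⟨f, hf⟩ := hS.exists_map_not_lift hp hT hT'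
  exact hf (H f)

lemma winding_eq_of_homotopicRel (f : C(Y, UnitAddCircle)) {a b : Y} {c c' : Path a b}
    (h : c.toContinuousMap.HomotopicRel c'.toContinuousMap {0, 1}) : winding f c = winding f c' := by
  obtain ⟨r, hr⟩ := QuotientAddGroup.mk_surjective (f a)
  have cov := UnitAddCircle.isCoveringMap_coe
  have h₀ : (f.comp c.toContinuousMap) 0 = ((r : ℝ) : UnitAddCircle) := by simpa using hr.symm
  have h₀' : (f.comp c'.toContinuousMap) 0 = ((r : ℝ) : UnitAddCircle) := by simpa using hr.symm
  rw [winding_eq f c (cov.liftPath _ r h₀).continuous (congrFun (cov.liftPath_lifts _ r h₀)),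
    winding_eq f c' (cov.liftPath _ r h₀').continuous (congrFun (cov.liftPath_lifts _ r h₀')),
    cov.liftPath_apply_one_eq_of_homotopicRel (h.comp_continuousMap f) r h₀ h₀',
    cov.liftPath_zero, cov.liftPath_zero]

lemma winding_eq_of_projClass_eq (cov : IsCoveringMap p) (f : C(Y, UnitAddCircle)) {α β : Path e e}
    (h : projClass p he he α = projClass p he he β) : winding f α = winding f β :=
  winding_eq_of_homotopicRel f
    ((cov.homotopicRel_iff_comp ⟨0, by simp, by simp⟩).2 (projClass_eq_iff.1 h))

end Main

end

theorem theorem1p1 {S : Type*} [TopologicalSpace S] {g n : ℕ} (hS : IsHyperbolicSurface g n S)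
    (x₀ : S) (K : Subgroup (FundamentalGroup S x₀)) [K.Characteristic] [K.FiniteIndex]
    {Y : Type*} [TopologicalSpace Y] (p : C(Y, S)) (e : Y) (he : p e = x₀)
    (hp : IsAssociatedCover K p e he)
    (ψ : FundamentalGroup S x₀ ≃* FundamentalGroup S x₀)
    (hψ : inducedAut K ψ ≠ MulEquiv.refl _) :
    (∃ a b : H1 Y, H1Action p e he ψ a b ∧ b ≠ a) ∧
      ∀ (f : S ≃ₜ S) (hf : f x₀ = x₀),
        (∀ γ, FundamentalGroup.mapOfEq (f : C(S, S)) hf γ = ψ γ) →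
          (∃! F : Y ≃ₜ Y, IsBasedLift p e f F) ∧
            ∀ F : Y ≃ₜ Y, IsBasedLift p e f F → H1map (F : C(Y, Y)) ≠ 𝟙 (H1 Y) := by
  have := hS.locallyPathConnectedSpace
  have := hp.covering.locallyPathConnectedSpace
  obtain ⟨α, β, θ, hβ, hθ⟩ := hS.exists_winding_ne hp hψ
  refine ⟨⟨loopClass α, loopClass β, ⟨α, β, rfl, rfl, ?_⟩,
    fun h ↦ hθ (winding_eq_of_loopClass_eq h).symm⟩, fun f hf H ↦
    ⟨hp.existsUnique_isBasedLift f hf H, fun F hF hF1 ↦ ?_⟩⟩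
  · rw [mapOfEq_fromPath, mapOfEq_fromPath, hβ]
  · let β' : Path e e := (α.map F.continuous).cast hF.2.symm hF.2.symm
    have hβ' : projClass p he he β' = projClass p he he β := by
      rw [hβ, ← H, FundamentalGroup.mapOfEq_apply]
      refine congrArg Path.Homotopic.Quotient.mk ?_
      ext t
      exact hF.1 _
    have h1 := H1map_loopClass α (F : C(Y, Y))
    rw [hF1] at h1
    have h2 : winding θ α = winding θ (α.map F.continuous) := winding_eq_of_loopClass_eq h1
    exact hθ (h2.trans (winding_eq_of_projClass_eq hp.covering θ hβ'))
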